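/- Let $I$ be a nonempty compact interval in the real line and let $f : I \to I$ be a continuous map; $f^n$ denotes the $n$-th iterate of $f$. For a compact interval $J \subset I$, a map $g : I \to I$ is called turbulent on $J$ if there are two nondegenerate compact subintervals $J_0, J_1$ of $J$ with at most one point in common such that $g(J_0) \cap g(J_1) \supset J_0 \cup J_1$. The map $g$ is called doubly turbulent (on $I$) if there are two nondegenerate compact subintervals $K, L$ of $I$ with at most one point in common such that $g$ is turbulent on $K$ and on $L$. Periods are least periods. A point $x \in I$ is chain recurrent if for every $\varepsilon > 0$ there are $n \ge 1$ and points $x_0 = x, x_1, \dots, x_n = x$ of $I$ with $|f(x_i) - x_{i+1}| < \varepsilon$ for $0 \le i \le n-1$. The $\omega$-limit set $\omega_f(b)$ of $b \in I$ is the set of limit points of the sequence $(f^n(b))_{n \ge 0}$. A point $x \in I$ is asymptotically periodic of period 1 or 2 if there is $y \in I$ with $f^2(y) = y$ and $\lim_{n\to\infty} |f^n(x) - f^n(y)| = 0$. The map $f$ is densely chaotic if the set of pairs $(x,y) \in I \times I$ with $\limsup_{n\to\infty} |f^n(x) - f^n(y)| > 0$ and $\liminf_{n\to\infty} |f^n(x)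 - f^n(y)| = 0$ is dense in $I \times I$. Then each of the following conditions implies that $f$ has periodic points of all even periods $2, 4, 6, \dots$ and that $f^2$ is doubly turbulent: (1) There are a point $c \in I$ and an odd integer $n > 1$ such that $f^n(c) \le c < f(c)$ or $f(c) < c \le f^n(c)$. In particular, the conclusion holds if $f$ has a periodic point of odd period $> 1$. (2) The chain recurrent points of $f$ are dense in $I$, and $f^2(a) \ne a$ for some point $a \in I$. (3) The $\omega$-limit set $\omega_f(b)$ of some point $b \in I$ contains a fixed point $z$ of $f$ and a point different from $z$. (4) There is a point in $I$ that is not asymptotically periodic of period 1 or 2, and the set $\{(x,y) \in I \times I : \liminf_{n\to\infty} |f^n(x) - f^n(y)| = 0\}$ is dense in $I \times I$. In particular, the conclusion holds if $f$ is densely chaotic. (5) There is a point $c \in I$ such that $\limsup_{n\to\infty} |f^n(c) - f^{n+1}(c)| > 0$ and $\liminf_{n\to\infty} |f^n(c) - f^{n+1}(c)| = 0$. -/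

import Mathlib

open Filter Topology Set

/-- `g` is turbulent on the subset `J` of a linearly ordered space (in the use below, `J` is a
compact interval): there are two nondegenerate compact intervals `[p, q]` and `[r, s]` in `J`, with
at most one point in common, such that the image of each of them contains both of them. -/
def IsTurbulentOn {X : Type*} [LinearOrder X] (g : X → X) (J : Set X) : Prop :=
  ∃ p q r s : X, p < q ∧ r < s ∧ Icc p q ⊆ J ∧ Icc r s ⊆ J ∧
    (Icc p q ∩ Icc r s).Subsingleton ∧
    Icc p q ∪ Icc r s ⊆ g '' Icc p q ∩ g '' Icc r s

/-- `g` is doubly turbulent: it is turbulent on each of two (nondegenerate) compact intervals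
`K = [k₁, k₂]` and `L = [l₁, l₂]` that have at most one point in common. -/
def IsDoublyTurbulent {X : Type*} [LinearOrder X] (g : X → X) : Prop :=
  ∃ k₁ k₂ l₁ l₂ : X, k₁ < k₂ ∧ l₁ < l₂ ∧ (Icc k₁ k₂ ∩ Icc l₁ l₂).Subsingleton ∧
    IsTurbulentOn g (Icc k₁ k₂) ∧ IsTurbulentOn g (Icc l₁ l₂)

/-- `g` has periodic points of all even (least) periods. -/
def HasAllEvenPeriods {X : Type*} (g : X → X) : Prop :=
  ∀ m : ℕ, 1 ≤ m → ∃ x : X, Function.minimalPeriod g x = 2 * m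

/-- `x` is a chain recurrent point of `g`: for every `ε > 0` there is an `ε`-chain with at least
one step from `x` to itself. -/
def IsChainRecurrentPt {X : Type*} [PseudoMetricSpace X] (g : X → X) (x : X) : Prop :=
  ∀ ε : ℝ, 0 < ε → ∃ (n : ℕ) (u : ℕ → X), 1 ≤ n ∧ u 0 = x ∧ u n = x ∧
    ∀ i < n, dist (g (u i)) (u (i + 1)) < ε

/-- The `ω`-limit set of the point `b` under iteration of `g`. -/
def omegaLimitSet {X : Type*} [TopologicalSpace X] (g : X → X) (b : X) : Set X :=
  omegaLimit atTop (fun (n : ℕ) (x : X) => g^[n] x) {b}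

/-- `x` is asymptotically periodic of period 1 or 2: its orbit is asymptotic to the orbit of a
point `y` with `g² y = y`. -/
def IsAsymptPeriodicOneOrTwo {X : Type*} [PseudoMetricSpace X] (g : X → X) (x : X) : Prop :=
  ∃ y : X, g (g y) = y ∧ Tendsto (fun n : ℕ => dist (g^[n] x) (g^[n] y)) atTop (𝓝 0)

/-- The pairs whose orbits come arbitrarily close to each other. -/
def proximalPairs {X : Type*} [PseudoMetricSpace X] (g : X → X) : Set (X × X) :=
  {w | liminf (fun n : ℕ => dist (g^[n] w.1) (g^[n] w.2)) atTop = 0}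

/-- The Li–Yorke pairs of `g`. -/
def liYorkePairs {X : Type*} [PseudoMetricSpace X] (g : X → X) : Set (X × X) :=
  {w | 0 < limsup (fun n : ℕ => dist (g^[n] w.1) (g^[n] w.2)) atTop ∧
    liminf (fun n : ℕ => dist (g^[n] w.1) (g^[n] w.2)) atTop = 0}

/-- `g` is densely chaotic: its Li–Yorke pairs are dense in the product. -/
def IsDenselyChaotic {X : Type*} [PseudoMetricSpace X] (g : X → X) : Prop :=
  Dense (liYorkePairs g)

/-! ### Elementary facts on continuous real functions -/

/-! Everything passes through one configuration, `Turn`: points a < e < b on one side of some z,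
sent by F to the other side of z (equality with z allowed), over which the graph of F² makes a fold
crossing the whole square over [a, b].

A turn gives the conclusion. Each leg of the fold contains an interval on which F stays beyond z and
whose F²-image covers [a, b]. A cyclic itinerary of length m that visits one leg once and the other
m - 1 times produces a point of F²-period m, and the position relative to z excludes an odd period
of F. Lifting the fold through F gives a second fold of F² beyond z, and two folds side by side make
F² doubly turbulent.

Conversely, a map without turns is rigid. There are three obstructions. A point sent by F to its own
side of a fixed point z, or to z, is a barrier for orbits that jump across z (`leftTurn_of_jump`).
No orbit makes an odd return of the kind in condition (1) (`turn_of_odd_return_le`). An orbit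
alternating around z cannot step away from z and later come arbitrarily close to it
(`leftTurn_of_return_limit`). It follows that every orbit converges to a fixed point or eventually
alternates around one (`tendsto_or_alternates`), and that an orbit accumulating at a fixed point
converges to it; this contradicts (3) and (5).

For (4), an orbit not asymptotic to period 1 or 2 alternates and makes a step away from its centre.
Points of this step and points of its image then move in opposite phase and stay apart, which yields
an open rectangle without proximal pairs. For (2), dense chain recurrence forbids regions mapped
well inside themselves (`NoTrap`). Without turns this leaves only the identity or a map exchanging
the two sides of a single fixed point, and in both cases F² is the identity on the interval.

The arguments run on the line, for the extension of f that is constant outside the interval;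
conjugation by x ↦ -x supplies the mirror cases. -/

theorem exists_first_eq {H : ℝ → ℝ} (hH : Continuous H) {p q r : ℝ} (hpq : p ≤ q)
    (hp : H p ≤ r) (hq : r ≤ H q) :
    ∃ t ∈ Icc p q, H t = r ∧ ∀ s, p ≤ s → s < t → H s < r := by
  have hc : IsCompact (Icc p q ∩ {t | r ≤ H t}) :=
    isCompact_Icc.inter_right (isClosed_le continuous_const hH)
  obtain ⟨t, ⟨⟨htI, htr⟩, hmin⟩⟩ := hc.exists_isLeast ⟨q, ⟨hpq, le_rfl⟩, hq⟩
  have hlt : ∀ s, p ≤ s → s < t → H s < r := by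
    intro s hps hst
    by_contra! hcon
    exact absurd (hmin ⟨⟨hps, hst.le.trans htI.2⟩, hcon⟩) (not_le.2 hst)
  refine ⟨t, htI, ?_, hlt⟩
  obtain ⟨s, hs, hsr⟩ := intermediate_value_Icc htI.1 hH.continuousOn ⟨hp, htr⟩
  rcases hs.2.eq_or_lt with h | h
  · rw [← h]; exact hsr
  · exact absurd hsr (hlt s hs.1 h).ne

theorem exists_last_eq {H : ℝ → ℝ} (hH : Continuous H) {p q r : ℝ} (hpq : p ≤ q)
    (hp : H p ≤ r) (hq : r ≤ H q) :
    ∃ t ∈ Icc p q, H t = r ∧ ∀ s, t < s → s ≤ q → r < H s := by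
  have hc : Continuous fun x => -H (-x) := (hH.comp continuous_neg).neg
  obtain ⟨t, ht, htr, hlt⟩ := exists_first_eq hc (p := -q) (q := -p) (r := -r) (by linarith)
    (by simpa using hq) (by simpa using hp)
  refine ⟨-t, ⟨by linarith [ht.2], by linarith [ht.1]⟩, by linarith, fun s hs hsq => ?_⟩
  have := hlt (-s) (by linarith) (by linarith)
  simpa using this

/-- An interval on whose ends `H` takes the values `l` and `r` contains a subinterval with the same
property that `H` maps into `[l, r]`. -/
theorem exists_uIcc_mapsTo {H : ℝ → ℝ} (hH : Continuous H) {p q l r : ℝ} (hlr : l ≤ r)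
    (hp : H p = l) (hq : H q = r) :
    ∃ p' ∈ uIcc p q, ∃ q' ∈ uIcc p q, H p' = l ∧ H q' = r ∧ ∀ t ∈ uIcc p' q', H t ∈ Icc l r := by
  have key : ∀ {K : ℝ → ℝ}, Continuous K → ∀ {p q : ℝ}, p ≤ q → K p = l → K q = r →
      ∃ p' q', p ≤ p' ∧ p' ≤ q' ∧ q' ≤ q ∧ K p' = l ∧ K q' = r ∧
        ∀ t ∈ Icc p' q', K t ∈ Icc l r := by
    intro K hK p q hpq hp hq
    obtain ⟨q', hq', hqr, hq2⟩ := exists_first_eq hK hpq (hp.le.trans hlr) hq.ge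
    obtain ⟨p', hp', hpl, hp2⟩ := exists_last_eq hK (r := l) hq'.1 hp.le (hqr ▸ hlr)
    refine ⟨p', q', hp'.1, hp'.2, hq'.2, hpl, hqr, fun t ht => ⟨?_, ?_⟩⟩
    · rcases ht.1.eq_or_lt with h | h
      · rw [← h, hpl]
      · exact (hp2 t h ht.2).le
    · rcases ht.2.eq_or_lt with h | h
      · rw [h, hqr]
      · exact (hq2 t (hp'.1.trans ht.1) h).le
  rcases le_total p q with hpq | hpq
  · obtain ⟨p', q', h1, h2, h3, h4, h5, h6⟩ := key hH hpq hp hq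
    refine ⟨p', ?_, q', ?_, h4, h5, ?_⟩
    · rw [uIcc_of_le hpq]; exact ⟨h1, h2.trans h3⟩
    · rw [uIcc_of_le hpq]; exact ⟨h1.trans h2, h3⟩
    · rw [uIcc_of_le h2]; exact h6
  · obtain ⟨p', q', h1, h2, h3, h4, h5, h6⟩ := key (hH.comp continuous_neg) (neg_le_neg hpq)
      (by simpa using hp) (by simpa using hq)
    refine ⟨-p', ?_, -q', ?_, h4, h5, ?_⟩
    · rw [uIcc_of_ge hpq]; constructor <;> linarith
    · rw [uIcc_of_ge hpq]; constructor <;> linarith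
    · intro t ht
      rw [uIcc_of_ge (by linarith)] at ht
      simpa using h6 (-t) ⟨by linarith [ht.2], by linarith [ht.1]⟩

/-- A point of the first of finitely many intervals, each of which covers the next one, that
follows a prescribed itinerary. -/
theorem exists_itinerary {G : ℝ → ℝ} (hG : Continuous G) (l r : ℕ → ℝ) (hlr : ∀ i, l i ≤ r i)
    (n : ℕ) (hcov : ∀ i < n, Icc (l (i + 1)) (r (i + 1)) ⊆ G '' Icc (l i) (r i)) :
    ∃ c d, G^[n] c = l n ∧ G^[n] d = r n ∧
      ∀ t ∈ uIcc c d, ∀ i ≤ n, G^[i] t ∈ Icc (l i) (r i) := by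
  induction n with
  | zero =>
    refine ⟨l 0, r 0, rfl, rfl, fun t ht i hi => ?_⟩
    obtain rfl : i = 0 := by omega
    rwa [uIcc_of_le (hlr 0)] at ht
  | succ n ih =>
    obtain ⟨c, d, hc, hd, hcd⟩ := ih fun i hi => hcov i (by omega)
    have hGn := hG.iterate n
    obtain ⟨s, hs, hsl⟩ := hcov n (by omega) (left_mem_Icc.2 (hlr (n + 1)))
    obtain ⟨t, ht, htr⟩ := hcov n (by omega) (right_mem_Icc.2 (hlr (n + 1)))
    obtain ⟨s', hs', t', ht', hs2, ht2, hst⟩ := exists_uIcc_mapsTo hG (hlr (n + 1)) hsl htr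
    have hsub : uIcc s t ⊆ Icc (l n) (r n) := uIcc_subset_Icc hs ht
    have hImg : Icc (l n) (r n) ⊆ G^[n] '' uIcc c d := by
      have := intermediate_value_uIcc (a := c) (b := d) hGn.continuousOn
      rw [hc, hd, uIcc_of_le (hlr n)] at this
      exact this
    -- `G^[n]` need not be monotone on the interval found so far, so it is shrunk until its image
    -- under `G^[n]` stays between `s'` and `t'`.
    have main : ∃ c' ∈ uIcc c d, ∃ d' ∈ uIcc c d, G^[n] c' = s' ∧ G^[n] d' = t' ∧
        ∀ x ∈ uIcc c' d', G^[n] x ∈ uIcc s' t' := by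
      obtain ⟨c1, hc1, hc1'⟩ := hImg (hsub hs')
      obtain ⟨d1, hd1, hd1'⟩ := hImg (hsub ht')
      have hs3 : uIcc c1 d1 ⊆ uIcc c d := uIcc_subset_uIcc hc1 hd1
      rcases le_total s' t' with h | h
      · obtain ⟨p', hp', q', hq', h1, h2, h3⟩ := exists_uIcc_mapsTo hGn h hc1' hd1'
        exact ⟨p', hs3 hp', q', hs3 hq', h1, h2, by rwa [uIcc_of_le h]⟩
      · obtain ⟨p', hp', q', hq', h1, h2, h3⟩ := exists_uIcc_mapsTo hGn h hd1' hc1'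
        rw [uIcc_comm d1 c1] at hp' hq'
        exact ⟨q', hs3 hq', p', hs3 hp', h2, h1, by rwa [uIcc_of_ge h, uIcc_comm q' p']⟩
    obtain ⟨c', hc', d', hd', h1, h2, h3⟩ := main
    refine ⟨c', d', by rw [Function.iterate_succ_apply', h1, hs2],
      by rw [Function.iterate_succ_apply', h2, ht2], fun x hx i hi => ?_⟩
    rcases Nat.lt_or_ge n i with hi' | hi'
    · obtain rfl : i = n + 1 := by omega
      rw [Function.iterate_succ_apply']
      exact hst _ (h3 x hx)
    · exact hcd x (uIcc_subset_uIcc hc' hd' hx) i hi'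

/-! ### Turns, and reflection of a map in the origin -/

/-- The map on the line conjugate to `F` by `x ↦ -x`. -/
def reflect (F : ℝ → ℝ) : ℝ → ℝ := fun x => -F (-x)

theorem reflect_apply (F : ℝ → ℝ) (x : ℝ) : reflect F x = -F (-x) := rfl

theorem reflect_reflect (F : ℝ → ℝ) : reflect (reflect F) = F := by
  funext x; simp [reflect]

theorem Continuous.reflect {F : ℝ → ℝ} (hF : Continuous F) : Continuous (reflect F) :=
  (hF.comp continuous_neg).neg

theorem reflect_iterate (F : ℝ → ℝ) (n : ℕ) (x : ℝ) : (reflect F)^[n] x = -F^[n] (-x) := by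
  induction n with
  | zero => simp
  | succ n ih => simp only [Function.iterate_succ_apply', ih, reflect, neg_neg]

/-- The graph of `G` over `a < e < b` is shaped like `V` or like `Λ` and crosses the square over
`[a, b]` completely. -/
def HasTurn (G : ℝ → ℝ) (a e b : ℝ) : Prop :=
  a < e ∧ e < b ∧ ((b ≤ G a ∧ b ≤ G b ∧ G e ≤ a) ∨ (G a ≤ a ∧ G b ≤ a ∧ b ≤ G e))

/-- `F²` has a `V`-shaped turn at points to the left of some `z` that `F` maps to the right of
`z`. -/
def LeftTurn (F : ℝ → ℝ) : Prop :=
  ∃ a e b z, a < e ∧ e < b ∧ b ≤ z ∧ z ≤ F a ∧ z ≤ F e ∧ z ≤ F b ∧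
    b ≤ F (F a) ∧ b ≤ F (F b) ∧ F (F e) ≤ a

/-! ### Consequences of a turn: even periods and double turbulence -/

theorem exists_subinterval_cover {F : ℝ → ℝ} (hF : Continuous F) {p q u v z : ℝ}
    (hp : z ≤ F p) (hq : z ≤ F q) (hu : u ≤ v) (hpu : F (F p) ≤ u) (hqv : v ≤ F (F q)) :
    ∃ l r, l ≤ r ∧ Icc l r ⊆ uIcc p q ∧ (∀ t ∈ Icc l r, z ≤ F t) ∧
      Icc u v ⊆ (fun x => F (F x)) '' Icc l r := by
  have main : ∃ p' ∈ uIcc p q, ∃ q' ∈ uIcc p q, F p' = F p ∧ F q' = F q ∧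
      ∀ t ∈ uIcc p' q', z ≤ F t := by
    rcases le_total (F p) (F q) with h | h
    · obtain ⟨p', hp', q', hq', h1, h2, h3⟩ := exists_uIcc_mapsTo hF h rfl rfl
      exact ⟨p', hp', q', hq', h1, h2, fun t ht => hp.trans (h3 t ht).1⟩
    · obtain ⟨p', hp', q', hq', h1, h2, h3⟩ := exists_uIcc_mapsTo hF h (p := q) (q := p) rfl rfl
      rw [uIcc_comm q p] at hp' hq'
      exact ⟨q', hq', p', hp', h2, h1, fun t ht => hq.trans (h3 t (by rwa [uIcc_comm])).1⟩
  obtain ⟨p', hp', q', hq', h1, h2, h3⟩ := main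
  refine ⟨min p' q', max p' q', min_le_max, uIcc_subset_uIcc hp' hq', h3, ?_⟩
  have := intermediate_value_uIcc (a := p') (b := q') (hF.comp hF).continuousOn
  refine Subset.trans ?_ this
  simp only [Function.comp_apply, h1, h2]
  rw [uIcc_of_le (hpu.trans (hu.trans hqv))]
  exact Icc_subset_Icc hpu hqv

/-- One visit to the left leg in each cycle of length m forces least period m under F², since the
legs meet at most in e. That F exceeds or equals z on both chosen intervals rules out odd periods of
F. -/
theorem LeftTurn.exists_minimalPeriod {F : ℝ → ℝ} (hF : Continuous F) (h : LeftTurn F) (m : ℕ)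
    (hm : 1 ≤ m) : ∃ x, Function.minimalPeriod F x = 2 * m := by
  obtain ⟨a, e, b, z, hae, heb, hbz, hza, hze, hzb, hFa, hFb, hFe⟩ := h
  obtain ⟨l0, r0, hlr0, hs0, hz0, hc0⟩ := exists_subinterval_cover hF hze hza
    (hae.le.trans heb.le) hFe hFa
  obtain ⟨l1, r1, hlr1, hs1, hz1, hc1⟩ := exists_subinterval_cover hF hze hzb
    (hae.le.trans heb.le) hFe hFb
  rw [uIcc_of_ge hae.le] at hs0
  rw [uIcc_of_le heb.le] at hs1
  set G : ℝ → ℝ := fun x => F (F x) with hGdef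
  have hG : Continuous G := hF.comp hF
  have hGF : ∀ (i : ℕ) (x : ℝ), F^[2 * i] x = G^[i] x := by
    intro i x; rw [Function.iterate_mul]; rfl
  have h0 : Icc l0 r0 ⊆ Icc a b := hs0.trans (Icc_subset_Icc le_rfl heb.le)
  have h1 : Icc l1 r1 ⊆ Icc a b := hs1.trans (Icc_subset_Icc hae.le le_rfl)
  let l : ℕ → ℝ := fun i => if i % m = 0 then l0 else l1
  let r : ℕ → ℝ := fun i => if i % m = 0 then r0 else r1
  have hlr : ∀ i, l i ≤ r i := by
    intro i; simp only [l, r]; split_ifs <;> assumption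
  have hab : ∀ i, Icc (l i) (r i) ⊆ Icc a b := by
    intro i; simp only [l, r]; split_ifs <;> assumption
  have hzz : ∀ i, ∀ t ∈ Icc (l i) (r i), z ≤ F t := by
    intro i; simp only [l, r]; split_ifs <;> assumption
  have hcov : ∀ i, Icc a b ⊆ G '' Icc (l i) (r i) := by
    intro i; simp only [l, r]; split_ifs <;> assumption
  obtain ⟨c, d, hc, hd, hcd⟩ := exists_itinerary hG l r hlr m fun i _ => (hab (i + 1)).trans (hcov i)
  have hl : l m = l 0 := by simp [l]
  have hr : r m = r 0 := by simp [r]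
  have hfix : ∃ x ∈ uIcc c d, G^[m] x = x := by
    have hcont : Continuous fun x => G^[m] x - x := (hG.iterate m).sub continuous_id
    have hcc := (hcd c left_mem_uIcc 0 (by omega)).1
    have hdd := (hcd d right_mem_uIcc 0 (by omega)).2
    simp only [Function.iterate_zero, id] at hcc hdd
    have := intermediate_value_uIcc (a := c) (b := d) hcont.continuousOn
    obtain ⟨x, hx, hx0⟩ := this (show (0 : ℝ) ∈ _ from by
      rw [uIcc_of_le (by rw [hc, hd, hl, hr]; linarith)]
      exact ⟨by rw [hc, hl]; linarith, by rw [hd, hr]; linarith⟩)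
    exact ⟨x, hx, by simpa [sub_eq_zero] using hx0⟩
  obtain ⟨x, hx, hxm⟩ := hfix
  have hxi := hcd x hx
  have hx0 : x ∈ Icc l0 r0 := by simpa [l, r] using hxi 0 (by omega)
  have hxe : x ≤ e := (hs0 hx0).2
  refine ⟨x, ?_⟩
  have hper : Function.IsPeriodicPt F (2 * m) x := by
    rw [Function.IsPeriodicPt, Function.IsFixedPt, hGF, hxm]
  obtain ⟨k, hk⟩ : ∃ k, Function.minimalPeriod F x = k := ⟨_, rfl⟩
  have hkdvd : k ∣ 2 * m := hk ▸ hper.minimalPeriod_dvd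
  have hkx : F^[k] x = x := hk ▸ Function.isPeriodicPt_minimalPeriod F x
  rw [hk]
  rcases Nat.even_or_odd k with ⟨d, rfl⟩ | ⟨j, rfl⟩
  · rw [← two_mul] at hkx hkdvd ⊢
    have hdm : d ∣ m := Nat.dvd_of_mul_dvd_mul_left (by norm_num) hkdvd
    rw [hGF] at hkx
    rcases (Nat.le_of_dvd (by omega) hdm).eq_or_lt with h | h
    · rw [h]
    exfalso
    have hd0 : 0 < d := Nat.pos_of_dvd_of_pos hdm (by omega)
    have hin : ∀ i, 0 < i → i < m → G^[i] x ∈ Icc e b := by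
      intro i hi him
      have := hxi i him.le
      simp only [l, r, Nat.mod_eq_of_lt him, hi.ne', if_false] at this
      exact hs1 this
    have h2 := hin d hd0 h
    rw [hkx] at h2
    -- A return at time d < m puts x on both legs, so x = e; but the next point must lie on the
    -- right leg, whereas F² sends e to at most a.
    obtain rfl : x = e := le_antisymm hxe h2.1
    have h3 := (hin 1 (by omega) (by omega)).1
    simp only [Function.iterate_one] at h3
    exact absurd (hFe.trans_lt hae) (not_lt.2 h3)
  · exfalso
    have hjm : (2 * j + 1) ∣ m := by
      refine Nat.Coprime.dvd_of_dvd_mul_left ?_ hkdvd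
      simp
    have := Nat.le_of_dvd (by omega) hjm
    replace hkx : F (F^[2 * j] x) = x :=
      (Function.iterate_succ_apply' F (2 * j) x).symm.trans hkx
    rw [hGF] at hkx
    -- An odd period would make x the F-image of a point of the chosen intervals, hence at least z,
    -- whereas x ≤ e < b ≤ z.
    have := hzz j _ (hxi j (by omega))
    linarith

theorem HasTurn.neg {F : ℝ → ℝ} {a e b : ℝ} (h : HasTurn (fun x => reflect F (reflect F x)) a e b) :
    HasTurn (fun x => F (F x)) (-b) (-e) (-a) := by
  obtain ⟨h1, h2, h3⟩ := h
  simp only [reflect, neg_neg] at h3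
  refine ⟨by linarith, by linarith, ?_⟩
  rcases h3 with ⟨h4, h5, h6⟩ | ⟨h4, h5, h6⟩
  · right; exact ⟨by linarith, by linarith, by linarith⟩
  · left; exact ⟨by linarith, by linarith, by linarith⟩

/-- The second turn lies beyond z, among points that F sends into [a, b]. On the range spanned by F
a, F e, F b the map F takes values at least b at the outer points and at most a at F e, so suitable
preimages exist. Whether a V or a Λ arises depends on the order of F a, F e, F b. -/
theorem LeftTurn.exists_two_turns {F : ℝ → ℝ} (hF : Continuous F) (h : LeftTurn F) :
    ∃ a e b a' e' b', b ≤ a' ∧ HasTurn (fun x => F (F x)) a e b ∧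
      HasTurn (fun x => F (F x)) a' e' b' := by
  obtain ⟨a, e, b, z, hae, heb, hbz, hza, hze, hzb, hFa, hFb, hFe⟩ := h
  have hab : a ≤ b := (hae.trans heb).le
  have inc : ∀ {u v y : ℝ}, u ≤ v → F u ≤ y → y ≤ F v → ∃ t, u ≤ t ∧ t ≤ v ∧ F t = y := by
    intro u v y huv h1 h2
    obtain ⟨t, ht, h⟩ := intermediate_value_Icc huv hF.continuousOn ⟨h1, h2⟩
    exact ⟨t, ht.1, ht.2, h⟩
  have dec : ∀ {u v y : ℝ}, u ≤ v → F v ≤ y → y ≤ F u → ∃ t, u ≤ t ∧ t ≤ v ∧ F t = y := by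
    intro u v y huv h1 h2
    obtain ⟨t, ht, h⟩ := intermediate_value_Icc' huv hF.continuousOn ⟨h1, h2⟩
    exact ⟨t, ht.1, ht.2, h⟩
  suffices H : ∃ a' e' b', z ≤ a' ∧ HasTurn (fun x => F (F x)) a' e' b' by
    obtain ⟨a', e', b', hz, ht⟩ := H
    exact ⟨a, e, b, a', e', b', hbz.trans hz, ⟨hae, heb, Or.inl ⟨hFa, hFb, hFe⟩⟩, ht⟩
  have lt_of_F : ∀ {s t : ℝ}, s ≤ t → F s ≠ F t → s < t := fun hst hne =>
    lt_of_le_of_ne hst fun h => hne (h ▸ rfl)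
  have lt_of_FF : ∀ {s t : ℝ}, s ≤ t → F (F s) ≠ F (F t) → s < t := fun hst hne =>
    lt_of_le_of_ne hst fun h => hne (h ▸ rfl)
  by_cases c1 : F e < min (F a) (F b)
  · have hw : b ≤ F (min (F a) (F b)) := by
      rcases min_choice (F a) (F b) with h | h <;> rw [h] <;> assumption
    have hwa := min_le_left (F a) (F b)
    have hwb := min_le_right (F a) (F b)
    set w := min (F a) (F b)
    obtain ⟨p, hp, hmin⟩ := isCompact_Icc.exists_isMinOn (nonempty_Icc.2 hab) hF.continuousOn
    have hpe : F p ≤ F e := hmin ⟨hae.le, heb.le⟩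
    obtain ⟨A, hA1, hA2, hA⟩ := inc c1.le hFe (hab.trans hw)
    obtain ⟨P, hP1, hP2, hP⟩ := inc hA2 (hA.le.trans hp.1) (hp.2.trans hw)
    obtain ⟨B, hB1, hB2, hB⟩ := inc hP2 (hP.le.trans hp.2) hw
    refine ⟨A, P, B, hze.trans hA1, lt_of_FF hP1 ?_, lt_of_FF hB1 ?_, Or.inl ⟨?_, ?_, ?_⟩⟩ <;>
      simp only [hA, hP, hB]
    · exact (by linarith : F p < F a).ne'
    · exact (by linarith : F p < F b).ne
    · linarith
    · linarith
    · linarith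
  by_cases c2 : max (F a) (F b) < F e
  · have hw : b ≤ F (max (F a) (F b)) := by
      rcases max_choice (F a) (F b) with h | h <;> rw [h] <;> assumption
    have hwa := le_max_left (F a) (F b)
    have hwb := le_max_right (F a) (F b)
    set w := max (F a) (F b)
    obtain ⟨p, hp, hmax⟩ := isCompact_Icc.exists_isMaxOn (nonempty_Icc.2 hab) hF.continuousOn
    have hpe : F e ≤ F p := hmax ⟨hae.le, heb.le⟩
    obtain ⟨A, hA1, hA2, hA⟩ := dec c2.le (hFe.trans hab) hw
    obtain ⟨P, hP1, hP2, hP⟩ := dec hA2 (hFe.trans hp.1) (hp.2.trans hA.ge)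
    obtain ⟨B, hB1, hB2, hB⟩ := dec hP2 hFe (hp.1.trans hP.ge)
    refine ⟨A, P, B, by linarith, lt_of_FF hP1 ?_, lt_of_FF hB1 ?_, Or.inr ⟨?_, ?_, ?_⟩⟩ <;>
      simp only [hA, hP, hB]
    · exact (by linarith : F b < F p).ne
    · exact (by linarith : F a < F p).ne'
    · linarith
    · linarith
    · linarith
  rcases le_total (F a) (F b) with hle | hle
  · rw [min_eq_left hle, not_lt] at c1
    rw [max_eq_right hle, not_lt] at c2
    obtain ⟨B, hB1, hB2, hB⟩ := dec c1 (hFe.trans hab) hFa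
    obtain ⟨A, hA1, hA2, hA⟩ := dec hB2 hFe (hab.trans hB.ge)
    obtain ⟨C, hC1, hC2, hC⟩ := inc c2 (hFe.trans hab) hFb
    refine ⟨B, A, C, hza.trans hB1, lt_of_F hA1 ?_, lt_of_F (hA2.trans hC1) ?_, Or.inl ⟨?_, ?_, ?_⟩⟩
      <;> simp only [hA, hB, hC]
    · linarith
    · linarith
    · linarith
    · linarith
    · linarith
  · rw [min_eq_right hle, not_lt] at c1
    rw [max_eq_left hle, not_lt] at c2
    obtain ⟨B, hB1, hB2, hB⟩ := dec c1 (hFe.trans hab) hFb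
    obtain ⟨A, hA1, hA2, hA⟩ := dec hB2 hFe (hab.trans hB.ge)
    obtain ⟨C, hC1, hC2, hC⟩ := inc c2 (hFe.trans hab) hFa
    refine ⟨B, A, C, hzb.trans hB1, lt_of_F hA1 ?_, lt_of_F (hA2.trans hC1) ?_, Or.inr ⟨?_, ?_, ?_⟩⟩
      <;> simp only [hA, hB, hC]
    · linarith
    · linarith
    · linarith
    · linarith
    · linarith

theorem minimalPeriod_reflect (F : ℝ → ℝ) (x : ℝ) :
    Function.minimalPeriod (reflect F) x = Function.minimalPeriod F (-x) := by
  rw [Function.minimalPeriod_eq_minimalPeriod_iff]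
  intro n
  simp only [Function.IsPeriodicPt, Function.IsFixedPt, reflect_iterate]
  exact neg_eq_iff_eq_neg

/-- `F²` has a turn on one side of a point, in the sense of `LeftTurn`. -/
def Turn (F : ℝ → ℝ) : Prop := LeftTurn F ∨ LeftTurn (reflect F)

theorem turn_reflect {F : ℝ → ℝ} : Turn (reflect F) ↔ Turn F := by
  rw [Turn, Turn, reflect_reflect, or_comm]

theorem Turn.exists_minimalPeriod {F : ℝ → ℝ} (hF : Continuous F) (h : Turn F) (m : ℕ)
    (hm : 1 ≤ m) : ∃ x, Function.minimalPeriod F x = 2 * m := by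
  rcases h with h | h
  · exact h.exists_minimalPeriod hF m hm
  · obtain ⟨x, hx⟩ := h.exists_minimalPeriod hF.reflect m hm
    exact ⟨-x, by rw [← minimalPeriod_reflect, hx]⟩

theorem Turn.exists_two_turns {F : ℝ → ℝ} (hF : Continuous F) (h : Turn F) :
    ∃ a e b a' e' b', b ≤ a' ∧ HasTurn (fun x => F (F x)) a e b ∧
      HasTurn (fun x => F (F x)) a' e' b' := by
  rcases h with h | h
  · exact h.exists_two_turns hF
  · obtain ⟨a, e, b, a', e', b', hle, h1, h2⟩ := h.exists_two_turns hF.reflect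
    exact ⟨_, _, _, _, _, _, neg_le_neg hle, h2.neg, h1.neg⟩

/-! ### Barriers: a point that stays on its side of a fixed point -/

/-- Pull y back to u in [w, z] and z back to t in [v, u]: then F² sends t and z to z, and u to at
most t. As a barrier principle: if F v ≤ z, an orbit point in (v, z) that jumps beyond z cannot land
at or below v next. -/
theorem leftTurn_of_jump {F : ℝ → ℝ} (hF : Continuous F) {z v w y : ℝ} (hz : F z = z) (hvw : v < w)
    (hwz : w < z) (hv : F v ≤ z) (hzy : z < y) (hyw : y ≤ F w) (hy : F y ≤ v) : LeftTurn F := by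
  obtain ⟨u, hu, huy⟩ := intermediate_value_Icc' hwz.le hF.continuousOn
    (show y ∈ Icc (F z) (F w) from ⟨by rw [hz]; exact hzy.le, hyw⟩)
  have huz : u < z := lt_of_le_of_ne hu.2 fun h => by rw [h, hz] at huy; exact hzy.ne huy
  obtain ⟨t, ht, htz, -⟩ := exists_last_eq hF (r := z) (hvw.le.trans hu.1) hv (by rw [huy]; exact hzy.le)
  have htu : t < u := lt_of_le_of_ne ht.2 fun h => by rw [h, huy] at htz; exact hzy.ne' htz
  refine ⟨t, u, z, z, htu, huz, le_rfl, htz.ge, by rw [huy]; exact hzy.le, hz.ge, ?_, ?_, ?_⟩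
  · rw [htz, hz]
  · rw [hz, hz]
  · rw [huy]; exact hy.trans ht.1

theorem leftTurn_reflect_of_jump {F : ℝ → ℝ} (hF : Continuous F) {z v w y : ℝ} (hz : F z = z)
    (hwv : w < v) (hzw : z < w) (hv : z ≤ F v) (hyz : y < z) (hyw : F w ≤ y) (hy : v ≤ F y) :
    LeftTurn (reflect F) := by
  refine leftTurn_of_jump hF.reflect (z := -z) (v := -v) (w := -w) (y := -y) ?_ ?_ ?_ ?_ ?_ ?_ ?_
    <;> simp only [reflect, neg_neg, neg_le_neg_iff, neg_lt_neg_iff, hz] <;> assumption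

/-! ### Odd returns -/

/-- Take the highest orbit point `x m` that moves up and the first fixed point z above it. Without
turns, barriers force the orbit from `x m` to alternate strictly around z. At time n it is at or
below its start, so the start inherits the same constraints and also alternates; an odd number of
steps then ends on the wrong side. -/
theorem turn_of_odd_return_le {F : ℝ → ℝ} (hF : Continuous F) {B : ℝ} (hB : ∀ x, F x ≤ B) {c : ℝ}
    {n : ℕ} (hn : Odd n) (h1 : F^[n] c ≤ c) (h2 : c < F c) : Turn F := by
  by_contra hno
  obtain ⟨hL, hR⟩ : ¬LeftTurn F ∧ ¬LeftTurn (reflect F) := not_or.1 hno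
  obtain ⟨x, hx⟩ : ∃ x : ℕ → ℝ, ∀ i, x i = F^[i] c := ⟨_, fun _ => rfl⟩
  have hx0 : x 0 = c := hx 0
  have hxs : ∀ i, x (i + 1) = F (x i) := fun i => by
    rw [hx, hx, Function.iterate_succ_apply']
  have hn0 : 0 < n := hn.pos
  have hret : x n ≤ x 0 := by rw [hx, hx0]; exact h1
  have hup : x 0 < x 1 := by rw [hxs, hx0]; exact h2
  obtain ⟨m, hm, hmax⟩ := Finset.exists_max_image ((Finset.range n).filter fun i => x i < x (i + 1)) x
    ⟨0, by simp [hn0, hup]⟩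
  have hmn : m < n := by simpa using (Finset.mem_filter.1 hm).1
  have hmu : x m < x (m + 1) := (Finset.mem_filter.1 hm).2
  have hU : ∀ i < n, x i < x (i + 1) → x i ≤ x m := fun i hi hlt =>
    hmax i (Finset.mem_filter.2 ⟨Finset.mem_range.2 hi, hlt⟩)
  -- Strictly between `x m` and this z the map moves points up, so by the maximality of `x m` the
  -- orbit up to time n has no point there.
  obtain ⟨z, hzI, hz, hzlt⟩ := exists_first_eq (H := fun t => t - F t) (continuous_id.sub hF)
    (p := x m) (q := max (x m) B) (r := 0) (le_max_left _ _) (by rw [← hxs]; linarith)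
    (by have := hB (max (x m) B); have := le_max_right (x m) B; linarith)
  have hzF : F z = z := by linarith
  have hmz : x m < z := lt_of_le_of_ne hzI.1 fun h => by rw [← h, ← hxs] at hz; linarith
  have hstay : ∀ i j, x i = F (x i) → x (i + j) = x i := by
    intro i j hi
    induction j with
    | zero => rfl
    | succ j ih => rw [← add_assoc, hxs, ih, ← hi]
  have hxnm : x n ≤ x m := hret.trans (hU 0 hn0 hup)
  have hne : ∀ i ≤ n, x i ≠ z := by
    intro i hi h
    have := hstay i (n - i) (by rw [h, hzF])
    rw [Nat.add_sub_cancel' hi] at this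
    linarith
  have hleft : ∀ i ≤ n, x i < z → x i ≤ x m := by
    intro i hi hlt
    by_contra! hcon
    rcases hi.eq_or_lt with rfl | hi
    · linarith
    have := hzlt (x i) hcon.le hlt
    rw [← hxs] at this
    linarith [hU i hi (by linarith)]
  have hright : ∀ i < n, z < x i → x (i + 1) < x i := by
    intro i hi hlt
    rcases lt_trichotomy (x (i + 1)) (x i) with h | h | h
    · exact h
    · have := hstay i (n - i) (by rw [← hxs, h])
      rw [Nat.add_sub_cancel' hi.le] at this
      linarith
    · linarith [hU i hi h]
  have hm1 : z < x (m + 1) := by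
    rcases lt_trichotomy (x (m + 1)) z with h | h | h
    · linarith [hleft (m + 1) (by omega) h]
    · exact absurd h (hne _ (by omega))
    · exact h
  have hdesc : ∀ k i, i + k = n → z < x i → ∃ j < n, i ≤ j ∧ z < x j ∧ x j ≤ x i ∧ x (j + 1) < z := by
    intro k
    induction k with
    | zero => intro i hi hzi; rw [add_zero] at hi; subst hi; linarith
    | succ k ih =>
      intro i hi hzi
      rcases lt_or_gt_of_ne (hne (i + 1) (by omega)) with h | h
      · exact ⟨i, by omega, le_rfl, hzi, le_rfl, h⟩
      · obtain ⟨j, hj, hij, h1, h2, h3⟩ := ih (i + 1) (by omega) h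
        exact ⟨j, hj, by omega, h1, h2.trans (hright i (by omega) hzi).le, h3⟩
  -- `V` and `W` record the steps that fail to change side. `InvL` says that y is nearer to z than
  -- every left barrier, and that every right barrier has a point between it and z which F sends to
  -- at most y. If the image of y then landed at or beyond a right barrier, there would be a turn;
  -- so the image satisfies `InvR`.
  let V : ℕ → Prop := fun i => i < n ∧ x i < z ∧ x (i + 1) < z
  let W : ℕ → Prop := fun i => i < n ∧ z < x i ∧ z < x (i + 1)
  let InvL : ℝ → Prop := fun y =>
    y < z ∧ (∀ i, V i → x i < y) ∧ ∀ i, W i → ∃ w, z < w ∧ w < x i ∧ F w ≤ y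
  let InvR : ℝ → Prop := fun y =>
    z < y ∧ (∀ i, W i → y < x i) ∧ ∀ i, V i → ∃ w, x i < w ∧ w < z ∧ y ≤ F w
  have stepL : ∀ i < n, InvL (x i) → InvR (x (i + 1)) := by
    rintro i hi ⟨hy, hyV, hyW⟩
    have hpos : z < x (i + 1) := by
      rcases lt_or_gt_of_ne (hne (i + 1) (by omega)) with h | h
      · exact absurd (hyV i ⟨hi, hy, h⟩) (lt_irrefl _)
      · exact h
    refine ⟨hpos, fun j hj => ?_, fun j hj => ⟨x i, hyV j hj, hy, (hxs i).le⟩⟩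
    by_contra! hcon
    obtain ⟨w, hw1, hw2, hw3⟩ := hyW j hj
    exact hR (leftTurn_reflect_of_jump hF hzF hw2 hw1 (by rw [← hxs]; exact hj.2.2.le) hy hw3
      (by rw [← hxs]; exact hcon))
  have stepR : ∀ i < n, InvR (x i) → InvL (x (i + 1)) := by
    rintro i hi ⟨hy, hyW, hyV⟩
    have hpos : x (i + 1) < z := by
      rcases lt_or_gt_of_ne (hne (i + 1) (by omega)) with h | h
      · exact h
      · exact absurd (hyW i ⟨hi, hy, h⟩) (lt_irrefl _)
    refine ⟨hpos, fun j hj => ?_, fun j hj => ⟨x i, hy, hyW j hj, (hxs i).ge⟩⟩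
    by_contra! hcon
    obtain ⟨w, hw1, hw2, hw3⟩ := hyV j hj
    exact hL (leftTurn_of_jump hF hzF hw1 hw2 (by rw [← hxs]; exact hj.2.2.le) hy hw3
      (by rw [← hxs]; exact hcon))
  have run : ∀ i, InvL (x i) → ∀ j, i + j ≤ n → (Even j → InvL (x (i + j))) ∧
      (Odd j → InvR (x (i + j))) := by
    intro i hi j
    induction j with
    | zero => intro _; exact ⟨fun _ => hi, fun h => absurd h (by decide)⟩
    | succ j ih =>
      intro hj
      obtain ⟨ih1, ih2⟩ := ih (by omega)
      rw [← add_assoc]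
      exact ⟨fun h => stepR _ (by omega) (ih2 (by simpa [Nat.even_add_one] using h)),
        fun h => stepL _ (by omega) (ih1 (by simpa [Nat.odd_add_one] using h))⟩
  have startm : InvL (x m) := by
    refine ⟨hmz, fun i hi => ?_, fun i hi => ?_⟩
    · refine lt_of_le_of_ne (hleft i hi.1.le hi.2.1) fun h => ?_
      have : x (i + 1) = x (m + 1) := by rw [hxs, hxs, h]
      linarith [hi.2.2]
    -- The orbit ends on the left, so after a `W`-step it descends to a last point `x j` before
    -- crossing z; this serves as the required w.
    · obtain ⟨j, hj, hij, h1, h2, h3⟩ := hdesc (n - i) i (by have := hi.1; omega) hi.2.1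
      refine ⟨x j, h1, lt_of_le_of_ne h2 fun h => ?_, ?_⟩
      · have : x (j + 1) = x (i + 1) := by rw [hxs, hxs, h]
        linarith [hi.2.2]
      · rw [← hxs]; exact hleft (j + 1) (by omega) h3
  have hn_left : InvL (x n) := by
    have := run m startm (n - m) (by omega)
    rw [Nat.add_sub_cancel' hmn.le] at this
    rcases Nat.even_or_odd (n - m) with h | h
    · exact this.1 h
    · linarith [(this.2 h).1]
  -- `InvL` survives moving y up as long as y stays below z, and `x n ≤ x 0`.
  have start0 : InvL (x 0) := by
    obtain ⟨h1, h2, h3⟩ := hn_left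
    refine ⟨(hU 0 hn0 hup).trans_lt hmz, fun i hi => (h2 i hi).trans_le hret, fun i hi => ?_⟩
    obtain ⟨w, hw1, hw2, hw3⟩ := h3 i hi
    exact ⟨w, hw1, hw2, hw3.trans hret⟩
  have := ((run 0 start0 n (by omega)).2 hn).1
  rw [zero_add] at this
  linarith

theorem turn_of_odd_return_ge {F : ℝ → ℝ} (hF : Continuous F) {A : ℝ} (hA : ∀ x, A ≤ F x) {c : ℝ}
    {n : ℕ} (hn : Odd n) (h1 : c ≤ F^[n] c) (h2 : F c < c) : Turn F := by
  refine turn_reflect.1 (turn_of_odd_return_le hF.reflect (B := -A) (c := -c)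
    (fun x => neg_le_neg (hA _)) hn ?_ ?_)
  · rw [reflect_iterate, neg_neg]; exact neg_le_neg h1
  · simpa [reflect] using h2

/-! ### Paths that come back up -/

/-- The step down to the minimum of the path supplies the middle point of a V. Since the path
finally rises above all its earlier points, either it climbs gradually enough to supply both ends of
the V, or it leaps to the top from a point below that middle point. -/
theorem path_turn_or_jump {G : ℝ → ℝ} {p : ℕ → ℝ} {k : ℕ} (hk : 1 ≤ k) (h10 : p 1 < p 0)
    (hG0 : G (p 0) ≤ p 1) (hp : ∀ i, 1 ≤ i → i < k → p (i + 1) = G (p i))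
    (htop : ∀ i < k, p i < p k) :
    (∃ i < k, ∃ j < k, ∃ r < k, p i < p j ∧ p j < p r ∧ p r ≤ G (p i) ∧ p r ≤ G (p r) ∧
      G (p j) ≤ p i) ∨
    ∃ j < k, 2 ≤ k ∧ p (k - 1) < p j ∧ G (p j) ≤ p (k - 1) ∧ G (p j) ≤ p 1 := by
  have hk2 : 2 ≤ k := by
    by_contra! h
    obtain rfl : k = 1 := by omega
    linarith [htop 0 one_pos]
  -- The first index of the minimum, called j + 1 below, is strictly lower than its predecessor `p
  -- j`, which becomes the middle point.
  have hex : ∃ i, 1 ≤ i ∧ i ≤ k ∧ ∀ i', 1 ≤ i' → i' ≤ k → p i ≤ p i' := by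
    obtain ⟨i, hi, hmin⟩ := Finset.exists_min_image (Finset.Icc 1 k) p ⟨1, by simp [hk]⟩
    rw [Finset.mem_Icc] at hi
    exact ⟨i, hi.1, hi.2, fun i' h1 h2 => hmin i' (Finset.mem_Icc.2 ⟨h1, h2⟩)⟩
  classical
  obtain ⟨hs1, hs2, hmin⟩ := Nat.find_spec hex
  have hfirst := fun i => Nat.find_min hex (m := i)
  obtain ⟨j, hj⟩ : ∃ j, Nat.find hex = j + 1 := ⟨Nat.find hex - 1, by omega⟩
  rw [hj] at hs1 hs2 hmin hfirst
  have hlt : p (j + 1) < p j := by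
    rcases Nat.eq_zero_or_pos j with rfl | h
    · exact h10
    · refine lt_of_le_of_ne (hmin j h (by omega)) fun he => ?_
      exact hfirst j (by omega) ⟨h, by omega, fun i' h1 h2 => he ▸ hmin i' h1 h2⟩
  have hGj : G (p j) ≤ p (j + 1) := by
    rcases Nat.eq_zero_or_pos j with rfl | h
    · exact hG0
    · exact (hp j h (by omega)).ge
  have hjk : j + 1 < k := by
    refine lt_of_le_of_ne hs2 fun h => ?_
    have := hmin 1 le_rfl hk
    rw [h] at this
    linarith [htop 0 (by omega)]
  set S := (Finset.range k).filter fun i => 1 ≤ i ∧ p i ≤ p j with hS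
  have memS : ∀ i, i ∈ S ↔ i < k ∧ 1 ≤ i ∧ p i ≤ p j := by simp [hS]
  have hSne : S.Nonempty := ⟨j + 1, (memS _).2 ⟨hjk, hs1, hlt.le⟩⟩
  -- n is the last visit at or below `p j`, and `i0` the visit with the highest successor. If n + 1
  -- < k, the last point before the path exceeds that successor is the right end of the V; otherwise
  -- the leap starts at `p (k - 1)`.
  obtain ⟨n, hnS, hnmax⟩ := Finset.exists_max_image S id hSne
  obtain ⟨i0, hi0S, hi0max⟩ := Finset.exists_max_image S (fun i => p (i + 1)) hSne
  obtain ⟨hnk, hn1, hnj⟩ := (memS n).1 hnS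
  obtain ⟨hi0k, hi01, hi0j⟩ := (memS i0).1 hi0S
  simp only [id] at hnmax
  rcases Nat.lt_or_ge (n + 1) k with hnk' | hnk'
  · left
    have hpn : p j < p (n + 1) := by
      by_contra! h
      have := hnmax (n + 1) ((memS _).2 ⟨hnk', by omega, h⟩)
      omega
    have hM : p (n + 1) ≤ p (i0 + 1) := hi0max n hnS
    have hi0k' : i0 + 1 < k := by have := hnmax i0 hi0S; omega
    have hMk := htop _ hi0k'
    have hex2 : ∃ r, n + 1 < r ∧ p (i0 + 1) < p r := ⟨k, hnk', hMk⟩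
    obtain ⟨hr1, hr2⟩ := Nat.find_spec hex2
    have hrmin := fun i => Nat.find_min hex2 (m := i)
    have hrk : Nat.find hex2 ≤ k := Nat.find_min' hex2 ⟨hnk', hMk⟩
    obtain ⟨r, hr⟩ : ∃ r, Nat.find hex2 = r + 1 := ⟨Nat.find hex2 - 1, by omega⟩
    rw [hr] at hr1 hr2 hrmin hrk
    have hrM : p r ≤ p (i0 + 1) := by
      rcases Nat.lt_or_ge (n + 1) r with h | h
      · by_contra! hcon
        exact hrmin r (by omega) ⟨h, hcon⟩
      · obtain rfl : r = n + 1 := by omega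
        exact hM
    have hrj : p j < p r := by
      by_contra! h
      have := hnmax r ((memS _).2 ⟨by omega, by omega, h⟩)
      omega
    have hGi : G (p i0) = p (i0 + 1) := (hp i0 hi01 hi0k).symm
    have hGr : G (p r) = p (r + 1) := (hp r (by omega) (by omega)).symm
    refine ⟨i0, hi0k, j, by omega, r, by omega, lt_of_le_of_ne hi0j fun h => ?_, hrj, by rw [hGi]; exact hrM,
      by rw [hGr]; linarith, hGj.trans (hmin i0 hi01 hi0k.le)⟩
    rw [h] at hGi
    linarith
  · right
    obtain rfl : n = k - 1 := by omega
    refine ⟨j, by omega, hk2, lt_of_le_of_ne hnj fun h => ?_, hGj.trans (hmin _ hn1 (by omega)),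
      hGj.trans (hmin 1 le_rfl hk)⟩
    have := hp (k - 1) hn1 hnk
    rw [h, Nat.sub_add_cancel hk] at this
    linarith [htop (j + 1) hjk]

theorem iterate_two_mul_succ (F : ℝ → ℝ) (i : ℕ) (x : ℝ) :
    F^[2 * (i + 1)] x = F (F (F^[2 * i] x)) := by
  rw [show 2 * (i + 1) = 2 * i + 1 + 1 by ring, Function.iterate_succ_apply',
    Function.iterate_succ_apply']

/-- A point `e` followed by the `F²`-orbit of `h`. -/
def consOrbit (F : ℝ → ℝ) (e h : ℝ) : ℕ → ℝ
  | 0 => e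
  | i + 1 => F^[2 * i] h

/-- `path_turn_or_jump` for F² along e, h, F² h, …. The start h only has to lie in [F² e, e), so
that whole steps and not just single orbits can be treated. -/
theorem leftTurn_or_jump_of_return {F : ℝ → ℝ} {z e h : ℝ} (hez : e < z)
    (heF : z ≤ F e) (hhe : h < e) (hFe : F (F e) ≤ h) {n : ℕ}
    (hs : ∀ i ≤ n, F^[2 * i] h < z ∧ z ≤ F (F^[2 * i] h)) (het : e < F^[2 * (n + 1)] h)
    (ht : ∀ i ≤ n, F^[2 * i] h < F^[2 * (n + 1)] h) :
    LeftTurn F ∨ ∃ q, F^[2 * n] h < q ∧ q < z ∧ z ≤ F q ∧ F (F q) ≤ F^[2 * n] h ∧ F (F q) ≤ h := by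
  have hz : ∀ i < n + 2, consOrbit F e h i < z ∧ z ≤ F (consOrbit F e h i) := by
    intro i hi
    cases i with
    | zero => exact ⟨hez, heF⟩
    | succ i => exact hs i (by omega)
  rcases path_turn_or_jump (G := fun x => F (F x)) (p := consOrbit F e h) (k := n + 2) (by omega)
    hhe hFe (fun i hi _ => by
      obtain ⟨i, rfl⟩ : ∃ j, i = j + 1 := ⟨i - 1, by omega⟩
      exact iterate_two_mul_succ F i h) (fun i hi => by
      cases i with
      | zero => exact het
      | succ i => exact ht i (by omega)) with
    ⟨i, hi, j, hj, r, hr, h1, h2, h3, h4, h5⟩ | ⟨j, hj, -, h1, h2, h3⟩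
  · left
    exact ⟨_, _, _, z, h1, h2, (hz r hr).1.le, (hz i hi).2, (hz j hj).2, (hz r hr).2, h3, h4, h5⟩
  · right
    exact ⟨_, h1, (hz j hj).1, (hz j hj).2, h2, h3⟩

/-- If the orbit reaches z or beyond, the leap alternative is a turn as well: its ends are the point
before the leap and the fixed point z. -/
theorem leftTurn_of_return_hit {F : ℝ → ℝ} {z e h : ℝ} (hz : F z = z) (hez : e < z)
    (heF : z ≤ F e) (hhe : h < e) (hFe : F (F e) ≤ h) {n : ℕ}
    (hs : ∀ i ≤ n, F^[2 * i] h < z ∧ z ≤ F (F^[2 * i] h)) (ht : z ≤ F^[2 * (n + 1)] h) :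
    LeftTurn F := by
  rcases leftTurn_or_jump_of_return hez heF hhe hFe hs (hez.trans_le ht)
    (fun i hi => (hs i hi).1.trans_le ht) with h | ⟨q, h1, h2, h3, h4, -⟩
  · exact h
  · refine ⟨_, q, z, z, h1, h2, le_rfl, (hs n le_rfl).2, h3, hz.ge, ?_, ?_, h4⟩
    · exact ht.trans_eq (iterate_two_mul_succ F n h)
    · rw [hz, hz]

/-- Without a turn, new heights near z are reached only by leaps from below a fixed distance η. A
limit of points two F²-steps before such heights gives q₂ with q = F² q₂ below z and F² q at least
z; then q, q₂, z form a turn. -/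
theorem leftTurn_of_return_limit {F : ℝ → ℝ} (hF : Continuous F) {A : ℝ} (hA : ∀ x, A ≤ F x)
    {z e h : ℝ} (hz : F z = z) (hez : e < z) (heF : z ≤ F e) (hhe : h < e) (hFe : F (F e) ≤ h)
    (hs : ∀ i, F^[2 * i] h < z ∧ z ≤ F (F^[2 * i] h)) (ht : ∀ L < z, ∃ i, L < F^[2 * i] h) :
    LeftTurn F := by
  by_contra hno
  obtain ⟨x, hx⟩ : ∃ x : ℕ → ℝ, ∀ i, x i = F^[2 * i] h := ⟨_, fun _ => rfl⟩
  have hxs : ∀ i, x (i + 1) = F (F (x i)) := fun i => by rw [hx, hx, iterate_two_mul_succ]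
  simp only [← hx] at hs ht
  have hx0 : x 0 = h := by rw [hx]; rfl
  have hlow : ∀ i, min A h ≤ x i := by
    intro i
    cases i with
    | zero => rw [hx0]; exact min_le_right _ _
    | succ i => rw [hxs]; exact (min_le_left _ _).trans (hA _)
  have hFF : Continuous fun t => F (F t) := hF.comp hF
  obtain ⟨η, hη, hηh⟩ : ∃ η > 0, ∀ t, z - η < t → t < z → h < F (F t) := by
    have h1 : ∀ᶠ t in 𝓝 z, h < F (F t) :=
      hFF.continuousAt.eventually (lt_mem_nhds (show h < F (F z) by rw [hz, hz]; linarith))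
    obtain ⟨η, hη, hb⟩ := Metric.eventually_nhds_iff.1 h1
    refine ⟨η, hη, fun t h1 h2 => hb ?_⟩
    rw [Real.dist_eq, abs_lt]; constructor <;> linarith
  -- At the first passage above L the point q of the leap satisfies F² q ≤ h, hence q ≤ z - η, and
  -- the leap starts below q.
  have hjump : ∀ L, e ≤ L → L < z → ∃ i, x i ≤ z - η ∧ L < x (i + 1) := by
    intro L heL hL
    classical
    have hex := ht L hL
    have hsp := Nat.find_spec hex
    have hmin := fun i => Nat.find_min hex (m := i)
    obtain ⟨n, hn⟩ : ∃ n, Nat.find hex = n + 1 := by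
      refine ⟨Nat.find hex - 1, ?_⟩
      have : Nat.find hex ≠ 0 := fun h0 => by rw [h0, hx0] at hsp; linarith
      omega
    rw [hn] at hsp hmin
    have hle : ∀ i ≤ n, x i ≤ L := fun i hi => not_lt.1 (hmin i (by omega))
    rcases leftTurn_or_jump_of_return (n := n) hez heF hhe hFe
      (fun i _ => by rw [← hx]; exact hs i) (by rw [← hx]; exact heL.trans_lt hsp)
      (fun i hi => by rw [← hx, ← hx]; exact (hle i hi).trans_lt hsp) with h | ⟨q, h1, h2, h3, h4, h5⟩
    · exact absurd h hno
    · refine ⟨n, ?_, hsp⟩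
      rw [← hx] at h1
      have : q ≤ z - η := by
        by_contra! hcon
        exact absurd (hηh q hcon h2) (not_lt.2 h5)
      linarith
  have hseq : ∀ N : ℕ, ∃ i, x (i + 1) ≤ z - η ∧ z - 1 / ((N : ℝ) + 1) < x (i + 2) ∧ N ≤ i := by
    intro N
    obtain ⟨m, -, hm⟩ := Finset.exists_max_image (Finset.range (N + 2)) x ⟨0, by simp⟩
    obtain ⟨i, hi1, hi2⟩ := hjump (max (max e (x m)) (z - 1 / ((N : ℝ) + 1)))
      ((le_max_left _ _).trans (le_max_left _ _))
      (max_lt (max_lt hez (hs m).1) (by linarith [Nat.one_div_pos_of_nat (α := ℝ) (n := N)]))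
    have hNi : N + 1 ≤ i := by
      by_contra! hcon
      have := hm (i + 1) (Finset.mem_range.2 (by omega))
      have h2 := (le_max_right e (x m)).trans (le_max_left _ (z - 1 / ((N : ℝ) + 1)))
      linarith
    obtain ⟨j, rfl⟩ : ∃ j, i = j + 1 := ⟨i - 1, by omega⟩
    exact ⟨j, hi1, (le_max_right _ _).trans_lt hi2, by omega⟩
  choose φ hφ1 hφ2 hφ3 using hseq
  obtain ⟨q₂, hq₂, ψ, hψ, hlim⟩ := (isCompact_Icc (a := min A h) (b := z)).tendsto_subseq
    (x := fun N => x (φ N)) fun N => ⟨hlow _, (hs _).1.le⟩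
  have hlim1 : Tendsto (fun N => x (φ (ψ N) + 1)) atTop (𝓝 (F (F q₂))) := by
    simp only [hxs]
    exact (hFF.tendsto q₂).comp hlim
  have hlim2 : Tendsto (fun N => x (φ (ψ N) + 2)) atTop (𝓝 (F (F (F (F q₂))))) := by
    simp only [hxs _]
    exact (hFF.tendsto _).comp ((hFF.tendsto q₂).comp hlim)
  have hFz : IsClosed {t | z ≤ F t} := isClosed_le continuous_const hF
  have hFq₂ : z ≤ F q₂ := hFz.mem_of_tendsto hlim (Eventually.of_forall fun N => (hs _).2)
  obtain ⟨q, hq⟩ : ∃ q, F (F q₂) = q := ⟨_, rfl⟩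
  rw [hq] at hlim1 hlim2
  have hFq : z ≤ F q := hFz.mem_of_tendsto hlim1 (Eventually.of_forall fun N => (hs _).2)
  have hqη : q ≤ z - η := le_of_tendsto hlim1 (Eventually.of_forall fun N => hφ1 _)
  have hFFq : z ≤ F (F q) := by
    have h1 : Tendsto (fun N => z - 1 / (((ψ N : ℕ) : ℝ) + 1)) atTop (𝓝 (z - 0)) :=
      tendsto_const_nhds.sub (tendsto_one_div_add_atTop_nhds_zero_nat.comp hψ.tendsto_atTop)
    rw [sub_zero] at h1
    exact le_of_tendsto_of_tendsto' h1 hlim2 fun N => (hφ2 _).le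
  have hqz : q < z := by linarith
  -- Falling from above q to q or below would make q, `x i`, z a turn. So the orbit is eventually
  -- above q, which gives q ≤ q₂.
  have hstay : ∀ i, q < x i → q < x (i + 1) := by
    intro i hi
    by_contra! hcon
    rw [hxs] at hcon
    exact hno ⟨q, x i, z, z, hi, (hs i).1, le_rfl, hFq, (hs i).2, hz.ge, hFFq, by rw [hz, hz], hcon⟩
  obtain ⟨i, hi⟩ := ht q hqz
  have hall : ∀ j, q < x (i + j) := by
    intro j
    induction j with
    | zero => exact hi
    | succ j ih => exact hstay _ ih
  have hqq : q ≤ q₂ := by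
    refine ge_of_tendsto hlim ?_
    filter_upwards [eventually_ge_atTop i] with N hN
    have h1 := hφ3 (ψ N)
    have h2 := hψ.le_apply (x := N)
    have := hall (φ (ψ N) - i)
    rw [Nat.add_sub_cancel' (by omega)] at this
    exact this.le
  have hne1 : q ≠ q₂ := fun hc => by rw [← hc] at hq; linarith
  have hne2 : q₂ ≠ z := fun hc => by rw [hc, hz, hz] at hq; linarith
  exact hno ⟨q, q₂, z, z, lt_of_le_of_ne hqq hne1, lt_of_le_of_ne hq₂.2 hne2, le_rfl, hFq, hFq₂,
    hz.ge, hFFq, by rw [hz, hz], hq.le⟩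

/-! ### Orbits that alternate around a fixed point -/

/-- The orbit of `y` alternates around `z`, starting on the left. -/
def Alternates (F : ℝ → ℝ) (z y : ℝ) : Prop :=
  ∀ n, F^[2 * n] y < z ∧ z < F (F^[2 * n] y)

theorem Alternates.iterate {F : ℝ → ℝ} {z y : ℝ} (h : Alternates F z y) (k : ℕ) :
    Alternates F z (F^[2 * k] y) := by
  intro n
  rw [← Function.iterate_add_apply, ← mul_add]
  exact h _

/-- An alternating orbit that comes arbitrarily close to the central fixed point converges to it. -/
theorem Alternates.tendsto {F : ℝ → ℝ} (hF : Continuous F) {A : ℝ} (hA : ∀ x, A ≤ F x)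
    (hno : ¬LeftTurn F) {z y : ℝ} (hz : F z = z) (hy : Alternates F z y)
    (hlim : ∀ L < z, ∃ᶠ n in atTop, L < F^[2 * n] y) :
    Tendsto (fun n => F^[2 * n] y) atTop (𝓝 z) := by
  -- A decrease would be a step away from z, and coming close to z after it forces a turn.
  have hmono : ∀ n, F^[2 * n] y ≤ F^[2 * (n + 1)] y := by
    intro n
    by_contra! hlt
    refine hno (leftTurn_of_return_limit hF hA hz (hy n).1 (hy n).2.le hlt
      (iterate_two_mul_succ F n y).ge ?_ ?_)
    · exact fun i => ⟨(hy.iterate (n + 1) i).1, (hy.iterate (n + 1) i).2.le⟩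
    · intro L hL
      obtain ⟨k, hk, hk2⟩ := (frequently_atTop.1 (hlim L hL)) (n + 1)
      refine ⟨k - (n + 1), ?_⟩
      rwa [← Function.iterate_add_apply, ← mul_add, Nat.sub_add_cancel hk]
  have hmono' : Monotone fun n => F^[2 * n] y := monotone_nat_of_le_succ hmono
  refine tendsto_order.2 ⟨fun L hL => ?_, fun L hL => Eventually.of_forall fun n => (hy n).1.trans hL⟩
  obtain ⟨k, hk⟩ := (hlim L hL).exists
  filter_upwards [eventually_ge_atTop k] with n hn
  exact hk.trans_le (hmono' hn)

theorem tendsto_of_even_odd {X : Type*} {l : Filter X} {u : ℕ → X}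
    (h1 : Tendsto (fun n => u (2 * n)) atTop l) (h2 : Tendsto (fun n => u (2 * n + 1)) atTop l) :
    Tendsto u atTop l := by
  intro s hs
  obtain ⟨N1, h1⟩ := eventually_atTop.1 (h1 hs)
  obtain ⟨N2, h2⟩ := eventually_atTop.1 (h2 hs)
  refine eventually_atTop.2 ⟨2 * (N1 + N2), fun n hn => ?_⟩
  rcases Nat.even_or_odd' n with ⟨k, rfl | rfl⟩
  · exact h1 k (by omega)
  · exact h2 k (by omega)

theorem tendsto_orbit_of_tendsto_even {F : ℝ → ℝ} (hF : Continuous F) {z y : ℝ} (hz : F z = z)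
    (h : Tendsto (fun n => F^[2 * n] y) atTop (𝓝 z)) :
    Tendsto (fun n => F^[n] y) atTop (𝓝 z) := by
  refine tendsto_of_even_odd h ?_
  simp only [Function.iterate_succ_apply']
  have := (hF.tendsto z).comp h
  rwa [hz] at this

/-- A step away from the central fixed point in an alternating orbit spans an interval all of whose
points have alternating orbits. -/
theorem Alternates.of_mem_step {F : ℝ → ℝ} (hF : Continuous F) (hno : ¬LeftTurn F) {z y : ℝ}
    (hz : F z = z) (hy : Alternates F z y) {h : ℝ} (h1 : F (F y) ≤ h) (h2 : h ≤ y) :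
    Alternates F z h := by
  -- The induction on time treats all points of the step at once, because the right-hand inequality
  -- at h needs an intermediate point t of the same step.
  have main : ∀ n, ∀ h, F (F y) ≤ h → h ≤ y → ∀ i < n, F^[2 * i] h < z ∧ z < F (F^[2 * i] h) := by
    intro n
    induction n with
    | zero => intro h _ _ i hi; omega
    | succ n ih =>
      intro h h1 h2 i hi
      rcases Nat.lt_or_ge i n with hin | hin
      · exact ih h h1 h2 i hin
      obtain rfl : i = n := by omega
      have hlt : ∀ h, F (F y) ≤ h → h ≤ y → F^[2 * i] h < z := by
        intro h h1 h2
        rcases h2.eq_or_lt with rfl | h2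
        · exact (hy i).1
        rcases Nat.eq_zero_or_pos i with rfl | hi0
        · exact h2.trans (hy 0).1
        obtain ⟨j, rfl⟩ : ∃ j, i = j + 1 := ⟨i - 1, by omega⟩
        by_contra! hcon
        exact hno (leftTurn_of_return_hit hz (hy 0).1 (hy 0).2.le h2 h1
          (fun k hk => ⟨(ih h h1 h2.le k (by omega)).1, (ih h h1 h2.le k (by omega)).2.le⟩) hcon)
      refine ⟨hlt h h1 h2, ?_⟩
      by_contra! hcon
      -- If the odd iterate fails to lie beyond z at h, some t of the step has that iterate exactly
      -- z; it then stays at z, a forbidden hit.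
      obtain ⟨t, ht, htz⟩ := intermediate_value_Icc h2
        (hF.comp (hF.iterate (2 * i))).continuousOn ⟨hcon, (hy i).2.le⟩
      simp only [Function.comp_apply] at htz
      rcases ht.2.eq_or_lt with rfl | hty
      · exact (hy i).2.ne' htz
      have hti := hlt t (h1.trans ht.1) ht.2
      refine hno (leftTurn_of_return_hit (n := i) hz (hy 0).1 (hy 0).2.le hty (h1.trans ht.1)
        (fun k hk => ?_) ?_)
      · rcases hk.eq_or_lt with rfl | hk
        · exact ⟨hti, htz.ge⟩
        · exact ⟨(ih t (h1.trans ht.1) ht.2 k hk).1, (ih t (h1.trans ht.1) ht.2 k hk).2.le⟩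
      · rw [iterate_two_mul_succ, htz, hz]
  exact fun n => main (n + 1) h h1 h2 n (by omega)

/-- Points of a step away from the central fixed point and points of its image stay apart. -/
theorem Alternates.exists_dist_ge {F : ℝ → ℝ} (hF : Continuous F) {A : ℝ} (hA : ∀ x, A ≤ F x)
    (hno : ¬LeftTurn F) {z y : ℝ} (hz : F z = z) (hy : Alternates F z y) {u w : ℝ}
    (hu1 : F (F y) ≤ u) (hu2 : u < y) (hw : w ∈ uIcc (F (F (F y))) (F y)) :
    ∃ δ > 0, ∀ n, δ ≤ |F^[n] u - F^[n] w| := by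
  have hu := hy.of_mem_step hF hno hz hu1 hu2.le
  -- Writing w as F v with v in the step shows that the orbits of u and w alternate in opposite
  -- phase.
  obtain ⟨v, hv, rfl⟩ := intermediate_value_uIcc (a := F (F y)) (b := y) hF.continuousOn hw
  rw [uIcc_of_le (hu1.trans hu2.le)] at hv
  have hv' := hy.of_mem_step hF hno hz hv.1 hv.2
  obtain ⟨L, hL, hLu⟩ : ∃ L < z, ∀ i, F^[2 * i] u ≤ L := by
    by_contra! hcon
    exact hno (leftTurn_of_return_limit hF hA hz (hy 0).1 (hy 0).2.le hu2 hu1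
      (fun i => ⟨(hu i).1, (hu i).2.le⟩) hcon)
  -- An odd iterate of u within δ of z would send the next even iterate above L.
  obtain ⟨δ, hδ, hδL⟩ : ∃ δ > 0, ∀ t, z < t → t < z + δ → L < F t := by
    have h1 : ∀ᶠ t in 𝓝 z, L < F t :=
      hF.continuousAt.eventually (lt_mem_nhds (by rw [hz]; exact hL))
    obtain ⟨η, hη, hb⟩ := Metric.eventually_nhds_iff.1 h1
    refine ⟨η, hη, fun t h1 h2 => hb ?_⟩
    rw [Real.dist_eq, abs_lt]; constructor <;> linarith
  refine ⟨min δ (z - L), lt_min hδ (by linarith), fun n => ?_⟩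
  rcases Nat.even_or_odd' n with ⟨k, rfl | rfl⟩
  · have h1 := hLu k
    have h2 := (hv' k).2
    rw [← Function.iterate_succ_apply' F, Function.iterate_succ_apply] at h2
    rw [abs_sub_comm]
    exact (min_le_right _ _).trans ((by linarith : z - L ≤ _).trans (le_abs_self _))
  · have h1 : z + δ ≤ F^[2 * k + 1] u := by
      rw [Function.iterate_succ_apply']
      by_contra! hcon
      have := hδL _ (hu k).2 hcon
      rw [← iterate_two_mul_succ F] at this
      linarith [hLu (k + 1)]
    have h2 : F^[2 * k + 1] (F v) < z := by
      rw [← Function.iterate_succ_apply]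
      exact (hv' (k + 1)).1
    exact (min_le_left _ _).trans ((by linarith : δ ≤ _).trans (le_abs_self _))

/-! ### Orbits of maps without turns -/

/-- Each left point whose image is also on the left is a barrier that later points respect. If the
supremum p of these barriers is z, the orbit is squeezed to z; if p < z, the orbit is caught near p
and never returns to the right. -/
theorem tendsto_of_frequently_same_side {F : ℝ → ℝ} (hF : Continuous F) (hno : ¬LeftTurn F)
    {x : ℕ → ℝ} (hx : ∀ i, x (i + 1) = F (x i)) {z : ℝ} (hz : F z = z)
    (hdiv : ∀ i, (x i < z ∧ x i < x (i + 1)) ∨ (z < x i ∧ x (i + 1) < x i))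
    (hright : ∃ᶠ i in atTop, z < x i) (hsame : ∃ᶠ i in atTop, x i < z ∧ x (i + 1) < z) :
    Tendsto x atTop (𝓝 z) := by
  have hl : ∀ {i}, x i < z → x i < x (i + 1) := fun {i} h => by
    rcases hdiv i with h1 | h1
    · exact h1.2
    · exact absurd h1.1 (not_lt.2 h.le)
  have hr : ∀ {i}, z < x i → x (i + 1) < x i := fun {i} h => by
    rcases hdiv i with h1 | h1
    · exact absurd h1.1 (not_lt.2 h.le)
    · exact h1.2
  have hne : ∀ {i}, ¬x i < z → z < x i := fun {i} h => by
    rcases hdiv i with h1 | h1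
    · exact absurd h1.1 h
    · exact h1.1
  have trap : ∀ v, v < z → F v ≤ z → ∀ i, v < x i → x i < z → ∀ j, i ≤ j → v < x j := by
    intro v hv hFv i hi hiz
    have : ∀ k, v < x (i + k) ∧ (z < x (i + k) → ∃ u, v < u ∧ u < z ∧ x (i + k) ≤ F u) := by
      intro k
      induction k with
      | zero => exact ⟨hi, fun h => absurd h (not_lt.2 hiz.le)⟩
      | succ k ih =>
        rw [← add_assoc]
        rcases hdiv (i + k) with ⟨h1, h2⟩ | ⟨h1, h2⟩
        · exact ⟨ih.1.trans h2, fun _ => ⟨_, ih.1, h1, (hx _).le⟩⟩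
        · obtain ⟨u, hu1, hu2, hu3⟩ := ih.2 h1
          refine ⟨?_, fun _ => ⟨u, hu1, hu2, h2.le.trans hu3⟩⟩
          by_contra! hcon
          rw [hx] at hcon
          exact hno (leftTurn_of_jump hF hz hu1 hu2 hFv h1 hu3 hcon)
    intro j hj
    have := (this (j - i)).1
    rwa [Nat.add_sub_cancel' hj] at this
  have hbar : ∀ i, x i < z → x (i + 1) < z → ∀ j, i < j → x i < x j := fun i h1 h2 j hj =>
    trap _ h1 (by rw [← hx]; exact h2.le) (i + 1) (hl h1) h2 j hj
  set S := {t | ∃ i, x i = t ∧ x i < z ∧ x (i + 1) < z} with hS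
  have hSne : S.Nonempty := by
    obtain ⟨i, hi⟩ := hsame.exists
    exact ⟨_, i, rfl, hi⟩
  have hSbdd : BddAbove S := ⟨z, by rintro _ ⟨i, rfl, hi, -⟩; exact hi.le⟩
  obtain ⟨p, hp⟩ : ∃ p, IsLUB S p := ⟨_, isLUB_csSup hSne hSbdd⟩
  have hpz : p ≤ z := hp.2 (by rintro _ ⟨i, rfl, hi, -⟩; exact hi.le)
  have hpcl : p ∈ closure S := hp.mem_closure hSne
  have happ : ∀ L < p, ∃ i, L < x i ∧ x i < z ∧ ∀ j, i ≤ j → L < x j := by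
    intro L hL
    obtain ⟨_, ⟨i, rfl, hi1, hi2⟩, hLi, -⟩ := hp.exists_between hL
    refine ⟨i, hLi, hi1, fun j hj => ?_⟩
    rcases hj.eq_or_lt with rfl | hj
    · exact hLi
    · exact hLi.trans (hbar i hi1 hi2 j hj)
  rcases hpz.eq_or_lt with rfl | hpz
  · rw [Metric.tendsto_atTop]
    intro ε hε
    obtain ⟨η, hη, hb⟩ := Metric.continuousAt_iff.1 (hF.continuousAt (x := p)) ε hε
    obtain ⟨i, hi1, hi2, hi3⟩ := happ (p - min η ε) (by linarith [lt_min hη hε])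
    refine ⟨i, fun j hj => ?_⟩
    have hup : ∀ k, x (i + k) < p + ε := by
      intro k
      induction k with
      | zero => rw [add_zero]; linarith
      | succ k ih =>
        rw [← add_assoc]
        rcases hdiv (i + k) with ⟨h1, h2⟩ | ⟨h1, h2⟩
        · have h3 := hi3 (i + k) (by omega)
          have h4 := hb (x := x (i + k)) (by
            rw [Real.dist_eq, abs_lt]; constructor <;> linarith [min_le_left η ε])
          rw [hz, ← hx, Real.dist_eq, abs_lt] at h4
          linarith
        · linarith
    have h1 := hi3 j hj
    have h2 := hup (j - i)
    rw [Nat.add_sub_cancel' hj] at h2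
    rw [Real.dist_eq, abs_lt]
    constructor <;> linarith [min_le_right η ε]
  · exfalso
    have hFpz : F p ≤ z := by
      refine closure_minimal (t := {t | F t ≤ z}) ?_ (isClosed_le hF continuous_const) hpcl
      rintro _ ⟨i, rfl, -, hi⟩
      rw [mem_ofPred_eq, ← hx]; exact hi.le
    -- F p ≤ z makes p itself a barrier: an orbit entering (p, z) would stay above p, yet it meets
    -- members of S, all at most p, infinitely often.
    have hleft : ∀ i, x i < z → x i ≤ p := by
      intro i hi
      by_contra! hcon
      obtain ⟨j, hj, hj1, hj2⟩ := (frequently_atTop.1 hsame) i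
      exact absurd (hp.1 ⟨j, rfl, hj1, hj2⟩) (not_le.2 (trap p hpz hFpz i hcon hi j hj))
    have hFp : F p ≤ p := by
      refine closure_minimal (t := {t | F t ≤ p}) ?_ (isClosed_le hF continuous_const) hpcl
      rintro _ ⟨i, rfl, -, hi⟩
      rw [mem_ofPred_eq, ← hx]; exact hleft _ hi
    obtain ⟨η, hη, hb⟩ := Metric.eventually_nhds_iff.1
      (hF.continuousAt.eventually (gt_mem_nhds (hFp.trans_lt hpz)))
    obtain ⟨i, hi1, hi2, hi3⟩ := happ (p - η) (by linarith)
    have hstay : ∀ k, x (i + k) < z := by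
      intro k
      induction k with
      | zero => exact hi2
      | succ k ih =>
        rw [← add_assoc, hx]
        refine hb ?_
        have h1 := hi3 (i + k) (by omega)
        have h2 := hleft _ ih
        rw [Real.dist_eq, abs_lt]; constructor <;> linarith
    obtain ⟨j, hj, hj1⟩ := (frequently_atTop.1 hright) i
    have := hstay (j - i)
    rw [Nat.add_sub_cancel' hj] at this
    linarith

/-! ### Every orbit converges to a fixed point or eventually alternates around one -/

theorem tendsto_of_eventually_le {F : ℝ → ℝ} (hF : Continuous F) {A B : ℝ}
    (hAB : ∀ x, F x ∈ Icc A B) {c : ℝ} (h : ∀ᶠ n in atTop, F^[n] c ≤ F^[n + 1] c) :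
    ∃ p, F p = p ∧ Tendsto (fun n => F^[n] c) atTop (𝓝 p) := by
  obtain ⟨N, hN⟩ := eventually_atTop.1 h
  have hmono : Monotone fun n => F^[n + N] c := monotone_nat_of_le_succ fun n => by
    rw [show n + 1 + N = n + N + 1 by ring]; exact hN _ (by omega)
  have hb : BddAbove (range fun n => F^[n + N] c) := by
    refine ⟨max B c, ?_⟩
    rintro _ ⟨n, rfl⟩
    simp only
    rcases Nat.eq_zero_or_pos (n + N) with h0 | h0
    · rw [h0]; exact le_max_right _ _
    · obtain ⟨k, hk⟩ : ∃ k, n + N = k + 1 := ⟨n + N - 1, by omega⟩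
      rw [hk, Function.iterate_succ_apply']
      exact (hAB _).2.trans (le_max_left _ _)
  have hlim := (tendsto_add_atTop_iff_nat (f := fun n => F^[n] c) N).1 (tendsto_atTop_ciSup hmono hb)
  exact ⟨_, isFixedPt_of_tendsto_iterate hlim hF.continuousAt, hlim⟩

theorem reflect_mem {F : ℝ → ℝ} {A B : ℝ} (hAB : ∀ x, F x ∈ Icc A B) (x : ℝ) :
    reflect F x ∈ Icc (-B) (-A) :=
  ⟨neg_le_neg (hAB _).2, neg_le_neg (hAB _).1⟩

theorem tendsto_reflect_iff {F : ℝ → ℝ} {c p : ℝ} :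
    Tendsto (fun n => (reflect F)^[n] c) atTop (𝓝 p) ↔
      Tendsto (fun n => F^[n] (-c)) atTop (𝓝 (-p)) := by
  simp only [reflect_iterate]
  constructor
  · intro h; simpa using h.neg
  · intro h; simpa using h.neg

theorem tendsto_of_eventually_ge {F : ℝ → ℝ} (hF : Continuous F) {A B : ℝ}
    (hAB : ∀ x, F x ∈ Icc A B) {c : ℝ} (h : ∀ᶠ n in atTop, F^[n + 1] c ≤ F^[n] c) :
    ∃ p, F p = p ∧ Tendsto (fun n => F^[n] c) atTop (𝓝 p) := by
  obtain ⟨p, hp, hlim⟩ := tendsto_of_eventually_le hF.reflect (reflect_mem hAB) (c := -c)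
    (by simpa only [reflect_iterate, neg_neg, neg_le_neg_iff] using h)
  rw [tendsto_reflect_iff, neg_neg] at hlim
  refine ⟨-p, ?_, hlim⟩
  rw [reflect] at hp
  linarith

/-- An orbit of a map without turns moves to the right on the left of some fixed point and to the
left on its right, unless it converges to a fixed point. -/
theorem exists_division {F : ℝ → ℝ} (hF : Continuous F) {A B : ℝ} (hAB : ∀ x, F x ∈ Icc A B)
    (hno : ¬Turn F) (c : ℝ) :
    (∃ p, F p = p ∧ Tendsto (fun n => F^[n] c) atTop (𝓝 p)) ∨
      (∃ᶠ n in atTop, F^[n] c < F^[n + 1] c) ∧ (∃ᶠ n in atTop, F^[n + 1] c < F^[n] c) ∧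
      ∃ z, F z = z ∧ ∀ n, (F^[n] c < z ∧ F^[n] c < F^[n + 1] c) ∨
        (z < F^[n] c ∧ F^[n + 1] c < F^[n] c) := by
  by_cases hconv : ∃ p, F p = p ∧ Tendsto (fun n => F^[n] c) atTop (𝓝 p)
  · exact Or.inl hconv
  right
  have hUf : ∃ᶠ n in atTop, F^[n] c < F^[n + 1] c := by
    by_contra hcon
    rw [not_frequently] at hcon
    exact hconv (tendsto_of_eventually_ge hF hAB (hcon.mono fun n hn => not_lt.1 hn))
  have hDf : ∃ᶠ n in atTop, F^[n + 1] c < F^[n] c := by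
    by_contra hcon
    rw [not_frequently] at hcon
    exact hconv (tendsto_of_eventually_le hF hAB (hcon.mono fun n hn => not_lt.1 hn))
  refine ⟨hUf, hDf, ?_⟩
  obtain ⟨x, hx⟩ : ∃ x : ℕ → ℝ, ∀ i, x i = F^[i] c := ⟨_, fun _ => rfl⟩
  simp only [← hx] at hUf hDf ⊢
  have hxs : ∀ i, x (i + 1) = F (x i) := fun i => by
    rw [hx, hx, Function.iterate_succ_apply']
  have hadd : ∀ i j, x (i + j) = F^[j] (x i) := fun i j => by
    rw [hx, hx, add_comm, Function.iterate_add_apply]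
  have hne : ∀ i, x (i + 1) ≠ x i := by
    intro i hi
    refine hconv ⟨x i, (hxs i).symm.trans hi, ?_⟩
    refine tendsto_const_nhds.congr' ?_
    filter_upwards [eventually_ge_atTop i] with n hn
    rw [← hx, ← Nat.add_sub_cancel' hn, hadd, Function.iterate_fixed ((hxs i).symm.trans hi)]
  have hodd1 : ∀ i j, Odd j → x i < x (i + 1) → x i < x (i + j) := by
    intro i j hj hi
    by_contra! hcon
    exact hno (turn_of_odd_return_le hF (fun t => (hAB t).2) (c := x i) hj
      (by rw [← hadd]; exact hcon) (by rw [← hxs]; exact hi))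
  have hodd2 : ∀ i j, Odd j → x (i + 1) < x i → x (i + j) < x i := by
    intro i j hj hi
    by_contra! hcon
    exact hno (turn_of_odd_return_ge hF (fun t => (hAB t).1) (c := x i) hj
      (by rw [← hadd]; exact hcon) (by rw [← hxs]; exact hi))
  -- For i < j one of j, j + 1 is at odd distance from i; since `x (j + 1) < x j`, excluding the odd
  -- return at either time suffices. The case j < i is symmetric.
  have hsep : ∀ i j, x i < x (i + 1) → x (j + 1) < x j → x i < x j := by
    intro i j hi hj
    rcases lt_trichotomy i j with h | rfl | h
    · obtain ⟨k, rfl⟩ := Nat.exists_eq_add_of_lt h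
      rcases Nat.even_or_odd (k + 1) with hk | hk
      · have := hodd1 i (k + 1 + 1) hk.add_one hi
        exact this.trans (by simpa only [add_assoc] using hj)
      · exact hodd1 i (k + 1) hk hi
    · exact absurd hi (not_lt.2 hj.le)
    · obtain ⟨k, rfl⟩ := Nat.exists_eq_add_of_lt h
      rcases Nat.even_or_odd (k + 1) with hk | hk
      · have := hodd2 j (k + 1 + 1) hk.add_one hj
        exact lt_trans (by simpa only [add_assoc] using hi) this
      · exact hodd2 j (k + 1) hk hj
  set U := {t | ∃ i, x i = t ∧ x i < x (i + 1)}
  set D := {t | ∃ i, x i = t ∧ x (i + 1) < x i}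
  have hUne : U.Nonempty := by obtain ⟨i, hi⟩ := hUf.exists; exact ⟨_, i, rfl, hi⟩
  have hDne : D.Nonempty := by obtain ⟨i, hi⟩ := hDf.exists; exact ⟨_, i, rfl, hi⟩
  have hUD : ∀ u ∈ U, ∀ d ∈ D, u ≤ d := by
    rintro _ ⟨i, rfl, hi⟩ _ ⟨j, rfl, hj⟩
    exact (hsep i j hi hj).le
  obtain ⟨p, hp⟩ : ∃ p, IsLUB U p :=
    ⟨_, isLUB_csSup hUne (hDne.imp fun d hd u hu => hUD u hu d hd)⟩
  obtain ⟨q, hq⟩ : ∃ q, IsGLB D q :=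
    ⟨_, isGLB_csInf hDne (hUne.imp fun u hu d hd => hUD u hu d hd)⟩
  have hpq : p ≤ q := hp.2 fun u hu => hq.2 fun d hd => hUD u hu d hd
  have hFp : p ≤ F p := by
    refine closure_minimal (t := {t | t ≤ F t}) ?_ (isClosed_le continuous_id hF)
      (hp.mem_closure hUne)
    rintro _ ⟨i, rfl, hi⟩
    rw [mem_ofPred_eq, ← hxs]; exact hi.le
  have hFq : F q ≤ q := by
    refine closure_minimal (t := {t | F t ≤ t}) ?_ (isClosed_le hF continuous_id)
      (hq.mem_closure hDne)
    rintro _ ⟨i, rfl, hi⟩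
    rw [mem_ofPred_eq, ← hxs]; exact hi.le
  obtain ⟨z, hz, hzF⟩ := intermediate_value_Icc hpq (continuous_id.sub hF).continuousOn
    (show (0 : ℝ) ∈ Icc _ _ from ⟨by simp only [Pi.sub_apply, id]; linarith,
      by simp only [Pi.sub_apply, id]; linarith⟩)
  have hzF' : F z = z := by simp only [Pi.sub_apply, id] at hzF; linarith
  have hxz : ∀ i, x i ≠ z := fun i h => hne i (by rw [hxs, h, hzF'])
  refine ⟨z, hzF', fun n => ?_⟩
  rcases lt_or_gt_of_ne (hne n) with h | h
  · exact Or.inr ⟨lt_of_le_of_ne (hz.2.trans (hq.1 ⟨n, rfl, h⟩)) (hxz n).symm, h⟩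
  · exact Or.inl ⟨lt_of_le_of_ne ((hp.1 ⟨n, rfl, h⟩).trans hz.1) (hxz n), h⟩

theorem tendsto_or_alternates {F : ℝ → ℝ} (hF : Continuous F) {A B : ℝ} (hAB : ∀ x, F x ∈ Icc A B)
    (hno : ¬Turn F) (c : ℝ) :
    (∃ p, F p = p ∧ Tendsto (fun n => F^[n] c) atTop (𝓝 p)) ∨
      ∃ z N, F z = z ∧ Alternates F z (F^[N] c) := by
  rcases exists_division hF hAB hno c with h | ⟨hUf, hDf, z, hz, hdiv⟩
  · exact Or.inl h
  by_cases hlim : Tendsto (fun n => F^[n] c) atTop (𝓝 z)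
  · exact Or.inl ⟨z, hz, hlim⟩
  right
  have hxs : ∀ i, F^[i + 1] c = F (F^[i] c) := fun i => Function.iterate_succ_apply' F i c
  have hrf : ∃ᶠ n in atTop, z < F^[n] c := hDf.mono fun n hn => by
    rcases hdiv n with h | h
    · exact absurd hn (not_lt.2 h.2.le)
    · exact h.1
  have hlf : ∃ᶠ n in atTop, F^[n] c < z := hUf.mono fun n hn => by
    rcases hdiv n with h | h
    · exact h.1
    · exact absurd hn (not_lt.2 h.2.le)
  have hL : ∀ᶠ n in atTop, ¬(F^[n] c < z ∧ F^[n + 1] c < z) := by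
    by_contra hcon
    exact hlim (tendsto_of_frequently_same_side hF (fun h => hno (Or.inl h)) hxs hz hdiv hrf hcon)
  have hR : ∀ᶠ n in atTop, ¬(z < F^[n] c ∧ z < F^[n + 1] c) := by
    by_contra hcon
    have := tendsto_of_frequently_same_side (x := fun n => -F^[n] c) (z := -z) hF.reflect
      (fun h => hno (Or.inr h)) (fun i => by simp [reflect, hxs]) (by simp [reflect, hz])
      (fun i => by simpa only [neg_lt_neg_iff] using (hdiv i).symm)
      (by simpa only [neg_lt_neg_iff] using hlf) (by simp only [neg_lt_neg_iff]; exact hcon)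
    exact hlim (by simpa using this.neg)
  obtain ⟨N0, hN0⟩ := eventually_atTop.1 (hL.and hR)
  obtain ⟨N, hN, hNz⟩ := (frequently_atTop.1 hlf) N0
  have hne : ∀ n, F^[n] c ≠ z := fun n h => by
    rcases hdiv n with h1 | h1
    · exact h1.1.ne h
    · exact h1.1.ne' h
  have up : ∀ n, N0 ≤ n → F^[n] c < z → z < F^[n + 1] c := fun n hn h =>
    lt_of_le_of_ne (not_lt.1 fun h2 => (hN0 n hn).1 ⟨h, h2⟩) (hne _).symm
  have down : ∀ n, N0 ≤ n → z < F^[n] c → F^[n + 1] c < z := fun n hn h =>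
    lt_of_le_of_ne (not_lt.1 fun h2 => (hN0 n hn).2 ⟨h, h2⟩) (hne _)
  refine ⟨z, N, hz, fun n => ?_⟩
  rw [← Function.iterate_add_apply, ← hxs]
  have : F^[2 * n + N] c < z := by
    induction n with
    | zero => simpa using hNz
    | succ n ih =>
      have := down _ (by omega) (up _ (by omega) ih)
      rwa [show 2 * (n + 1) + N = 2 * n + N + 1 + 1 by ring]
  exact ⟨this, up _ (by omega) this⟩

/-- If there are no turns, an orbit that comes arbitrarily close to a fixed point converges to
it. -/
theorem tendsto_of_frequently_near {F : ℝ → ℝ} (hF : Continuous F) {A B : ℝ}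
    (hAB : ∀ x, F x ∈ Icc A B) (hno : ¬Turn F) {c z : ℝ} (hz : F z = z)
    (hc : MapClusterPt z atTop fun n => F^[n] c) : Tendsto (fun n => F^[n] c) atTop (𝓝 z) := by
  rw [mapClusterPt_iff_frequently] at hc
  rcases tendsto_or_alternates hF hAB hno c with ⟨p, -, hlim⟩ | ⟨z', N, hz', halt⟩
  · obtain rfl : z = p := by
      by_contra hne
      obtain ⟨u, v, hu, hv, hzu, hpv, huv⟩ := t2_separation hne
      obtain ⟨n, h1, h2⟩ := ((hc u (hu.mem_nhds hzu)).and_eventually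
        (hlim (hv.mem_nhds hpv))).exists
      exact disjoint_left.1 huv h1 h2
    exact hlim
  have hcross : ∀ n, N ≤ n → (F^[n] c < z' ∧ z' < F (F^[n] c)) ∨ (z' < F^[n] c ∧ F (F^[n] c) < z') := by
    intro n hn
    obtain ⟨j, rfl⟩ := Nat.exists_eq_add_of_le' hn
    rw [Function.iterate_add_apply]
    rcases Nat.even_or_odd' j with ⟨k, rfl | rfl⟩
    · exact Or.inl (halt k)
    · right
      rw [Function.iterate_succ_apply', ← iterate_two_mul_succ F k]
      exact ⟨(halt k).2, (halt (k + 1)).1⟩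
  -- Close to a fixed point other than z', a point and its image lie on the same side of z', which
  -- the alternating orbit never allows.
  obtain rfl : z = z' := by
    rcases lt_trichotomy z z' with h | h | h
    · exfalso
      have h1 : ∀ᶠ t in 𝓝 z, t < z' ∧ F t < z' :=
        (gt_mem_nhds h).and (hF.continuousAt.eventually (gt_mem_nhds (by rwa [hz])))
      obtain ⟨n, hn, hnN⟩ := ((hc _ h1).and_eventually (eventually_ge_atTop N)).exists
      rcases hcross n hnN with h | h <;> linarith [hn.1, hn.2, h.1, h.2]
    · exact h
    · exfalso
      have h1 : ∀ᶠ t in 𝓝 z, z' < t ∧ z' < F t :=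
        (lt_mem_nhds h).and (hF.continuousAt.eventually (lt_mem_nhds (by rwa [hz])))
      obtain ⟨n, hn, hnN⟩ := ((hc _ h1).and_eventually (eventually_ge_atTop N)).exists
      rcases hcross n hnN with h | h <;> linarith [hn.1, hn.2, h.1, h.2]
  have hfr : ∀ L < z, ∃ᶠ n in atTop, L < F^[2 * n] (F^[N] c) := by
    intro L hL
    rw [frequently_atTop]
    intro M
    have h1 : ∀ᶠ t in 𝓝 z, L < t ∧ L < F t :=
      (lt_mem_nhds hL).and (hF.continuousAt.eventually (lt_mem_nhds (by rwa [hz])))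
    obtain ⟨n, hn, hnN⟩ := ((hc _ h1).and_eventually (eventually_ge_atTop (2 * M + N))).exists
    obtain ⟨j, rfl⟩ := Nat.exists_eq_add_of_le' (show N ≤ n by omega)
    rw [Function.iterate_add_apply] at hn
    rcases Nat.even_or_odd' j with ⟨k, rfl | rfl⟩
    · exact ⟨k, by omega, hn.1⟩
    · refine ⟨k + 1, by omega, ?_⟩
      rw [iterate_two_mul_succ, ← Function.iterate_succ_apply' F]
      exact hn.2
  have := tendsto_orbit_of_tendsto_even hF hz (halt.tendsto hF (fun x => (hAB x).1)
    (fun h => hno (Or.inl h)) hz hfr)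
  simp only [← Function.iterate_add_apply] at this
  exact (tendsto_add_atTop_iff_nat (f := fun n => F^[n] c) N).1 this

theorem turn_of_mapClusterPt {F : ℝ → ℝ} (hF : Continuous F) {A B : ℝ}
    (hAB : ∀ x, F x ∈ Icc A B) {c z y : ℝ} (hz : F z = z) (hyz : y ≠ z)
    (hcz : MapClusterPt z atTop fun n => F^[n] c) (hcy : MapClusterPt y atTop fun n => F^[n] c) :
    Turn F := by
  by_contra hno
  have hlim := tendsto_of_frequently_near hF hAB hno hz hcz
  obtain ⟨u, v, hu, hv, hyu, hzv, huv⟩ := t2_separation hyz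
  rw [mapClusterPt_iff_frequently] at hcy
  obtain ⟨n, h1, h2⟩ := ((hcy u (hu.mem_nhds hyu)).and_eventually (hlim (hv.mem_nhds hzv))).exists
  exact disjoint_left.1 huv h1 h2

/-- If there are no turns and consecutive points of an orbit come arbitrarily close, then the orbit
converges. -/
theorem exists_tendsto_of_frequently_dist_lt {F : ℝ → ℝ} (hF : Continuous F) {A B : ℝ}
    (hAB : ∀ x, F x ∈ Icc A B) (hno : ¬Turn F) {c : ℝ}
    (hc : ∀ ε > 0, ∃ᶠ n in atTop, |F^[n] c - F^[n + 1] c| < ε) :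
    ∃ p, F p = p ∧ Tendsto (fun n => F^[n] c) atTop (𝓝 p) := by
  rcases tendsto_or_alternates hF hAB hno c with h | ⟨z, N, hz, halt⟩
  · exact h
  refine ⟨z, hz, tendsto_of_frequently_near hF hAB hno hz ?_⟩
  rw [mapClusterPt_iff_frequently]
  intro s hs
  obtain ⟨ε, hε, hεs⟩ := Metric.mem_nhds_iff.1 hs
  refine ((hc ε hε).and_eventually (eventually_ge_atTop N)).mono fun n ⟨hn, hnN⟩ => hεs ?_
  rw [Metric.mem_ball, Real.dist_eq]
  -- Consecutive points lie on opposite sides of z, so each is nearer to z than to the other.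
  refine lt_of_le_of_lt ?_ hn
  obtain ⟨j, rfl⟩ := Nat.exists_eq_add_of_le' hnN
  rw [show j + N + 1 = (j + 1) + N by ring, Function.iterate_add_apply,
    Function.iterate_add_apply F (j + 1)]
  rcases Nat.even_or_odd' j with ⟨k, rfl | rfl⟩
  · have h1 := (halt k).1
    have h2 := (halt k).2
    rw [← Function.iterate_succ_apply' F] at h2
    rw [abs_of_neg (by linarith), abs_of_neg (by linarith)]
    linarith
  · have h1 := (halt k).2
    have h2 := (halt (k + 1)).1
    rw [← Function.iterate_succ_apply' F] at h1
    rw [show 2 * k + 1 + 1 = 2 * (k + 1) by ring, abs_of_pos (by linarith),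
      abs_of_pos (by linarith)]
    linarith

/-- The comparison point is F^N p: after N more steps it has made 2N steps from p and is back at p,
in phase with the orbit of c from time N on. -/
theorem exists_asymptotic_of_tendsto_even {F : ℝ → ℝ} (hF : Continuous F) {N : ℕ} {c p : ℝ}
    (hp : F (F p) = p) (hlim : Tendsto (fun n => F^[2 * n] (F^[N] c)) atTop (𝓝 p)) :
    ∃ y, F (F y) = y ∧ Tendsto (fun n => |F^[n] c - F^[n] y|) atTop (𝓝 0) := by
  have hfix : ∀ k, F^[2 * k] p = p := by
    intro k
    rw [Function.iterate_mul]
    exact Function.iterate_fixed (f := F^[2]) hp k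
  have hcomm : F (F (F^[N] p)) = F^[N] p := by
    rw [← Function.iterate_succ_apply' F, ← Function.iterate_succ_apply' F,
      Function.iterate_succ_apply, Function.iterate_succ_apply, hp]
  refine ⟨F^[N] p, hcomm, ?_⟩
  have h0 : Tendsto (fun n => |F^[n] (F^[N] c) - F^[n] p|) atTop (𝓝 0) := by
    refine tendsto_of_even_odd ?_ ?_
    · simp only [hfix]
      have := (hlim.sub_const p).abs
      rwa [sub_self, abs_zero] at this
    · simp only [Function.iterate_succ_apply', hfix]
      have := (((hF.tendsto p).comp hlim).sub_const (F p)).abs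
      rwa [sub_self, abs_zero] at this
  refine (tendsto_add_atTop_iff_nat (f := fun n => |F^[n] c - F^[n] (F^[N] p)|) N).1 ?_
  refine h0.congr fun n => ?_
  rw [Function.iterate_add_apply, Function.iterate_add_apply F n N (F^[N] p),
    ← Function.iterate_add_apply F N N p, ← two_mul, hfix]

/-- If there are no turns and some orbit is not asymptotic to an orbit of period 1 or 2, then the
pairs that are not proximal have interior points. -/
theorem exists_distal_intervals {F : ℝ → ℝ} (hF : Continuous F) {A B : ℝ}
    (hAB : ∀ x, F x ∈ Icc A B) (hno : ¬Turn F) {c : ℝ} (hcAB : c ∈ Icc A B)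
    (hc : ¬∃ y ∈ Icc A B, F (F y) = y ∧ Tendsto (fun n => |F^[n] c - F^[n] y|) atTop (𝓝 0)) :
    ∃ u₁ u₂ w₁ w₂, u₁ < u₂ ∧ w₁ < w₂ ∧ u₁ ∈ Icc A B ∧ u₂ ∈ Icc A B ∧ w₁ ∈ Icc A B ∧
      w₂ ∈ Icc A B ∧ ∀ u ∈ Ioo u₁ u₂, ∀ w ∈ Ioo w₁ w₂, ∃ δ > 0, ∀ n, δ ≤ |F^[n] u - F^[n] w| := by
  have hmem : ∀ y, F (F y) = y → y ∈ Icc A B := fun y hy => hy ▸ hAB _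
  have hitmem : ∀ n, F^[n] c ∈ Icc A B := by
    intro n
    cases n with
    | zero => exact hcAB
    | succ n => rw [Function.iterate_succ_apply']; exact hAB _
  rcases tendsto_or_alternates hF hAB hno c with ⟨p, hp, hlim⟩ | ⟨z, N, hz, halt⟩
  · refine absurd ⟨p, hp ▸ hAB _, by rw [hp, hp], ?_⟩ hc
    simp only [Function.iterate_fixed hp]
    have := (hlim.sub_const p).abs
    rwa [sub_self, abs_zero] at this
  -- If the even iterates never stepped away from z they would increase to a fixed point of F², and
  -- c would be asymptotic to its orbit.
  obtain ⟨k, hk⟩ : ∃ k, F^[2 * (k + 1)] (F^[N] c) < F^[2 * k] (F^[N] c) := by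
    by_contra! hcon
    obtain ⟨p, hp, hlim⟩ := tendsto_of_eventually_le (F := F^[2]) (hF.iterate 2) (A := A) (B := B)
      (fun x => hAB _) (c := F^[N] c) (Eventually.of_forall fun n => by
        simpa only [← Function.iterate_mul] using hcon n)
    simp only [← Function.iterate_mul] at hlim
    obtain ⟨y, hy1, hy2⟩ := exists_asymptotic_of_tendsto_even hF hp hlim
    exact hc ⟨y, hmem y hy1, hy1, hy2⟩
  have hyAB : F^[2 * k] (F^[N] c) ∈ Icc A B := by
    rw [← Function.iterate_add_apply]; exact hitmem _
  have halt' := halt.iterate k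
  rw [iterate_two_mul_succ] at hk
  obtain ⟨y, hy⟩ : ∃ y, F^[2 * k] (F^[N] c) = y := ⟨_, rfl⟩
  rw [hy] at hk hyAB halt'
  -- Otherwise the orbit of c would land on a point of period at most 2; so the second interval is
  -- nondegenerate.
  have hne : F (F (F y)) ≠ F y := by
    intro he
    have hfix : Tendsto (fun n => F^[2 * n] (F^[2 * k + 2 + N] c)) atTop (𝓝 (F (F y))) := by
      have h1 : F^[2 * k + 2 + N] c = F (F y) := by
        rw [Function.iterate_add_apply, show 2 * k + 2 = 2 * (k + 1) by ring,
          iterate_two_mul_succ, hy]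
      rw [h1]
      refine tendsto_const_nhds.congr fun n => ?_
      rw [Function.iterate_mul]
      exact (Function.iterate_fixed (f := F^[2]) (show F (F (F (F y))) = F (F y) by rw [he]) n).symm
    obtain ⟨y', hy1, hy2⟩ := exists_asymptotic_of_tendsto_even hF (by rw [he]) hfix
    exact hc ⟨y', hmem y' hy1, hy1, hy2⟩
  refine ⟨F (F y), y, min (F (F (F y))) (F y), max (F (F (F y))) (F y), hk, min_lt_max.2 hne,
    hAB _, hyAB, ?_, ?_, fun u hu w hw => ?_⟩
  · rcases min_choice (F (F (F y))) (F y) with h | h <;> rw [h] <;> exact hAB _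
  · rcases max_choice (F (F (F y))) (F y) with h | h <;> rw [h] <;> exact hAB _
  · exact halt'.exists_dist_ge hF (fun x => (hAB x).1) (fun h => hno (Or.inl h)) hz hu.1.le hu.2
      ⟨hw.1.le, hw.2.le⟩

/-! ### Maps without trapping regions -/

/-- No set that contains the `ε`-neighbourhood of its image contains an interval of `[A, B]` that
stays away from this neighbourhood. -/
def NoTrap (F : ℝ → ℝ) (A B : ℝ) : Prop :=
  ∀ C : Set ℝ, ∀ ε > 0, (∀ t ∈ C, ∀ s, |F t - s| < ε → s ∈ C) →
    ∀ u v, A ≤ u → v ≤ B → u < v → Ioo u v ⊆ C → ∃ x ∈ Ioo u v, ∃ t ∈ C, |F t - x| < ε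

theorem NoTrap.reflect {F : ℝ → ℝ} {A B : ℝ} (h : NoTrap F A B) :
    NoTrap (reflect F) (-B) (-A) := by
  intro C ε hε hC u v hu hv huv huC
  obtain ⟨x, hx, t, ht, htx⟩ := h (Neg.neg ⁻¹' C) ε hε (fun t ht s hs => hC (-t) ht (-s) (by
      rw [reflect_apply, neg_neg, neg_sub_neg, abs_sub_comm]; exact hs)) (-v) (-u) (by linarith)
    (by linarith) (by linarith) (fun s hs => huC ⟨by linarith [hs.2], by linarith [hs.1]⟩)
  refine ⟨-x, ⟨by linarith [hx.2], by linarith [hx.1]⟩, -t, ht, ?_⟩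
  rwa [reflect_apply, neg_neg, neg_sub_neg, abs_sub_comm]

/-- If F sent [a, b] into its interior, the strip between an end of [a, b] and the range of F would
be out of reach for small ε. The end inside [A, B] is used, so that the strip lies in [A, B]. -/
theorem NoTrap.not_mapsTo {F : ℝ → ℝ} (hF : Continuous F) {A B : ℝ} (hAB : ∀ x, F x ∈ Icc A B)
    (h : NoTrap F A B) {a b : ℝ} (hab : a < b) (hend : A ≤ a ∨ b ≤ B) :
    ¬∀ t ∈ Icc a b, a < F t ∧ F t < b := by
  intro hmap
  obtain ⟨p, hp, hmin⟩ := isCompact_Icc.exists_isMinOn (nonempty_Icc.2 hab.le) hF.continuousOn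
  obtain ⟨q, hq, hmax⟩ := isCompact_Icc.exists_isMaxOn (nonempty_Icc.2 hab.le) hF.continuousOn
  have hm : ∀ t ∈ Icc a b, F p ≤ F t := fun t ht => hmin ht
  have hM : ∀ t ∈ Icc a b, F t ≤ F q := fun t ht => hmax ht
  have h1 := (hmap p hp).1
  have h2 := (hmap q hq).2
  have hpq := hm q hq
  obtain ⟨ε, hε, hε1, hε2⟩ : ∃ ε > 0, 2 * ε ≤ F p - a ∧ 2 * ε ≤ b - F q :=
    ⟨min (F p - a) (b - F q) / 2, half_pos (lt_min (by linarith) (by linarith)),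
      by linarith [min_le_left (F p - a) (b - F q)], by linarith [min_le_right (F p - a) (b - F q)]⟩
  have hC : ∀ t ∈ Icc a b, ∀ s, |F t - s| < ε → s ∈ Icc a b := by
    intro t ht s hs
    rw [abs_lt] at hs
    have := hm t ht
    have := hM t ht
    constructor <;> linarith
  rcases hend with hend | hend
  · obtain ⟨x, hx, t, ht, htx⟩ := h _ ε hε hC a (F p - ε) hend (by linarith [(hAB p).2])
      (by linarith) (fun s hs => ⟨hs.1.le, by linarith [hs.2]⟩)
    rw [abs_lt] at htx
    linarith [hm t ht, hx.2]
  · obtain ⟨x, hx, t, ht, htx⟩ := h _ ε hε hC (F q + ε) b (by linarith [(hAB q).1]) hend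
      (by linarith) (fun s hs => ⟨by linarith [hs.1], hs.2.le⟩)
    rw [abs_lt] at htx
    linarith [hM t ht, hx.1]

/-- The trapping set is [a, b] together with a thin neighbourhood of its image. The image lies at or
beyond z > b, so it does not fill the strip just below b. -/
theorem NoTrap.not_mapsTo_sq {F : ℝ → ℝ} (hF : Continuous F) {A B : ℝ}
    (hAB : ∀ x, F x ∈ Icc A B) (h : NoTrap F A B) {a b z : ℝ} (hab : a < b) (hbz : b < z)
    (hzB : z ≤ B) (hz : ∀ t ∈ Icc a b, z ≤ F t) :
    ¬∀ t ∈ Icc a b, a < F (F t) ∧ F (F t) < b := by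
  intro hmap
  have hne := nonempty_Icc.2 hab.le
  obtain ⟨p, hp, hmin⟩ := isCompact_Icc.exists_isMinOn hne (hF.comp hF).continuousOn
  obtain ⟨q, hq, hmax⟩ := isCompact_Icc.exists_isMaxOn hne (hF.comp hF).continuousOn
  have hm : ∀ t ∈ Icc a b, F (F p) ≤ F (F t) := fun t ht => hmin ht
  have hM : ∀ t ∈ Icc a b, F (F t) ≤ F (F q) := fun t ht => hmax ht
  have h1 := (hmap p hp).1
  have h2 := (hmap q hq).2
  have hK : IsCompact (F '' Icc a b) := isCompact_Icc.image hF
  set a' := (a + F (F p)) / 2 with ha'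
  set b' := (b + F (F q)) / 2 with hb'
  have hU : IsOpen (F ⁻¹' Ioo a' b') := isOpen_Ioo.preimage hF
  have hKU : F '' Icc a b ⊆ F ⁻¹' Ioo a' b' := by
    rintro _ ⟨t, ht, rfl⟩
    have := hm t ht
    have := hM t ht
    constructor <;> linarith
  obtain ⟨δ, hδ, hthick⟩ := hK.exists_thickening_subset_open hU hKU
  obtain ⟨ε, hε, hε1, hε2, hε3, hε4⟩ : ∃ ε > 0, ε ≤ δ ∧ ε ≤ z - b ∧ ε ≤ a' - a ∧ 2 * ε ≤ b - b' := by
    refine ⟨min (min δ (z - b)) (min (a' - a) ((b - b') / 2)), ?_, ?_, ?_, ?_, ?_⟩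
    · exact lt_min (lt_min hδ (by linarith)) (lt_min (by linarith) (by linarith))
    · exact (min_le_left _ _).trans (min_le_left _ _)
    · exact (min_le_left _ _).trans (min_le_right _ _)
    · exact (min_le_right _ _).trans (min_le_left _ _)
    · linarith [(min_le_right (min δ (z - b)) (min (a' - a) ((b - b') / 2))).trans
        (min_le_right _ _)]
  obtain ⟨x, hx, t, ht, htx⟩ := h (Icc a b ∪ Metric.thickening δ (F '' Icc a b)) ε hε
    (by
      rintro t (ht | ht) s hs
      · right
        rw [Metric.mem_thickening_iff]
        exact ⟨F t, mem_image_of_mem F ht, by rw [dist_comm, Real.dist_eq]; linarith⟩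
      · left
        have := hthick ht
        rw [abs_lt] at hs
        constructor <;> linarith [this.1, this.2])
    (b - ε) b (by linarith [(hAB (F q)).1]) (by linarith) (by linarith)
    (fun s hs => Or.inl ⟨by linarith [hs.1, hm q hq], hs.2.le⟩)
  rw [abs_lt] at htx
  rcases ht with ht | ht
  · linarith [hz t ht, hx.2]
  · linarith [(hthick ht).2, hx.1]

/-- Let p be the first fixed point above x. Untrapped intervals ending below p force G to reach p to
the left of x; let y be the last such place. If G stayed above y on [y, p], an interval slightly
inside would be trapped. -/
theorem exists_turn_of_lt {G : ℝ → ℝ} (hG : Continuous G) {A : ℝ} (hA : ∀ x, A ≤ G x) {q x : ℝ}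
    (hq : G q = q) (hxq : x < q) (hx : G x < x)
    (htrap : ∀ a b, a < b → b < q → ¬∀ t ∈ Icc a b, a < G t ∧ G t < b) :
    ∃ y e p, y < e ∧ e < p ∧ p ≤ q ∧ G y = p ∧ G p = p ∧ G e ≤ y := by
  obtain ⟨p, hp, hp0, hlt⟩ := exists_first_eq (H := fun t => G t - t) (hG.sub continuous_id)
    (r := 0) hxq.le (by linarith) (by linarith)
  replace hp0 : G p = p := by linarith
  replace hlt : ∀ s, x ≤ s → s < p → G s < s := fun s h1 h2 => by linarith [hlt s h1 h2]
  have hxp : x < p := lt_of_le_of_ne hp.1 fun h => by rw [h, hp0] at hx; exact lt_irrefl _ hx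
  -- Since a₀ lies below all values of G, an interval starting at a₀ can only fail to be trapped at
  -- its right end.
  obtain ⟨a₀, ha₀A, ha₀x⟩ : ∃ a₀, a₀ < A ∧ a₀ < x :=
    ⟨min A x - 1, by linarith [min_le_left A x], by linarith [min_le_right A x]⟩
  obtain ⟨w, hw, hwmax⟩ := isCompact_Icc.exists_isMaxOn (nonempty_Icc.2 ha₀x.le) hG.continuousOn
  have hwp : p ≤ G w := by
    refine le_of_forall_lt_imp_le_of_dense fun y hy => ?_
    rcases le_or_gt y x with hyx | hyx
    · have := htrap a₀ x ha₀x hxq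
      push Not at this
      obtain ⟨t, ht, ht2⟩ := this
      exact hyx.trans ((ht2 (ha₀A.trans_le (hA t))).trans (hwmax ht))
    · have := htrap a₀ y (ha₀x.trans hyx) (hy.trans_le hp.2)
      push Not at this
      obtain ⟨t, ht, ht2⟩ := this
      have hyt := ht2 (ha₀A.trans_le (hA t))
      have htx : t ≤ x := by
        by_contra! hcon
        linarith [hlt t hcon.le (ht.2.trans_lt hy), ht.2]
      exact hyt.trans (hwmax ⟨ht.1, htx⟩)
  obtain ⟨y, hy, hyp, hylt⟩ := exists_last_eq (H := fun t => -G t) hG.neg (r := -p) hw.2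
    (by linarith) (by linarith)
  replace hyp : G y = p := by linarith
  replace hylt : ∀ s, y < s → s ≤ x → G s < p := fun s h1 h2 => by linarith [hylt s h1 h2]
  have hyx : y < x := lt_of_le_of_ne hy.2 fun h => by rw [h] at hyp; linarith
  obtain ⟨e, he, hemin⟩ := isCompact_Icc.exists_isMinOn (nonempty_Icc.2 (hyx.trans hxp).le)
    hG.continuousOn
  have hem : ∀ t ∈ Icc y p, G e ≤ G t := fun t ht => hemin ht
  refine ⟨y, e, p, ?_⟩
  by_cases hey : G e ≤ y
  · refine ⟨lt_of_le_of_ne he.1 ?_, lt_of_le_of_ne he.2 ?_, hp.2, hyp, hp0, hey⟩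
    · rintro rfl; linarith
    · rintro rfl; linarith
  exfalso
  rw [not_le] at hey
  obtain ⟨a, hya, ha⟩ := exists_between (lt_min hey hyx)
  have hax := ha.trans_le (min_le_right _ _)
  obtain ⟨s, hs, hsmax⟩ := isCompact_Icc.exists_isMaxOn (nonempty_Icc.2 hax.le) hG.continuousOn
  have hsp : G s < p := hylt s (hya.trans_le hs.1) hs.2
  obtain ⟨b, hb, hbp⟩ := exists_between (max_lt hsp hxp)
  have hb1 := (le_max_left _ _).trans_lt hb
  have hb2 := (le_max_right _ _).trans_lt hb
  refine htrap a b (hax.trans hb2) (hbp.trans_le hp.2) fun t ht => ⟨?_, ?_⟩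
  · exact (ha.trans_le (min_le_left _ _)).trans_le (hem t ⟨hya.le.trans ht.1, ht.2.trans hbp.le⟩)
  · rcases le_or_gt t x with htx | htx
    · exact lt_of_le_of_lt (hsmax ⟨ht.1, htx⟩) hb1
    · exact (hlt t htx.le (ht.2.trans_lt hbp)).trans_le ht.2

/-- In the fold for F itself, pulling y back twice along [e, p] gives an orbit c, s, y, p with s < c
≤ p: an odd return of length 3. -/
theorem NoTrap.le_of_lt_fixed {F : ℝ → ℝ} (hF : Continuous F) {A B : ℝ} (hAB : ∀ x, F x ∈ Icc A B)
    (h : NoTrap F A B) (hno : ¬Turn F) {q x : ℝ} (hq : F q = q) (hxq : x < q) : x ≤ F x := by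
  by_contra! hcon
  obtain ⟨y, e, p, hye, hep, -, hy, hp, he⟩ := exists_turn_of_lt hF (fun x => (hAB x).1) hq hxq hcon
    fun a b hab hbq => h.not_mapsTo hF hAB hab (Or.inr (hbq.le.trans (hq ▸ (hAB q).2)))
  obtain ⟨s, hs, hsy⟩ := intermediate_value_Icc hep.le hF.continuousOn
    ⟨he, hp.symm ▸ (hye.trans hep).le⟩
  obtain ⟨c, hc, hcs⟩ := intermediate_value_Icc hs.2 hF.continuousOn
    (show s ∈ Icc (F s) (F p) from ⟨by rw [hsy]; exact hye.le.trans hs.1, by rw [hp]; exact hs.2⟩)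
  refine hno (turn_of_odd_return_ge hF (fun x => (hAB x).1) (c := c) (n := 3) (by decide) ?_ ?_)
  · simp only [Function.iterate_succ_apply', Function.iterate_zero_apply]
    rw [hcs, hsy, hy]; exact hc.2
  · rw [hcs]
    refine lt_of_le_of_ne hc.1 fun h => ?_
    rw [← h, hsy] at hcs
    linarith [hs.1]

theorem NoTrap.ge_of_fixed_lt {F : ℝ → ℝ} (hF : Continuous F) {A B : ℝ} (hAB : ∀ x, F x ∈ Icc A B)
    (h : NoTrap F A B) (hno : ¬Turn F) {q x : ℝ} (hq : F q = q) (hxq : q < x) : F x ≤ x := by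
  have := h.reflect.le_of_lt_fixed hF.reflect (reflect_mem hAB) (fun h => hno (turn_reflect.1 h))
    (q := -q) (x := -x) (by rw [reflect_apply, neg_neg, hq]) (by linarith)
  rw [reflect_apply, neg_neg] at this
  linarith

/-- Suppose F v ≤ z. Since [v, B + 1] is not trapped, F returns to v or below at some point,
necessarily beyond z; let y₀ be the first place beyond z where F equals v. If F on [v, z] reaches
y₀, the jump through y₀ is a turn; if not, [v, b] is trapped for some b below y₀. -/
theorem NoTrap.lt_of_fixed {F : ℝ → ℝ} (hF : Continuous F) {A B : ℝ} (hAB : ∀ x, F x ∈ Icc A B)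
    (h : NoTrap F A B) (hno : ¬LeftTurn F) {z v : ℝ} (hz : F z = z) (hright : ∀ t, z < t → F t < t)
    (hleft : ∀ t, t < z → t ≤ F t) (hAv : A ≤ v) (hvz : v < z) (hv : v < F v) : z < F v := by
  by_contra! hcon
  have habove : ∀ t, v ≤ t → t ≤ z → v < F t := by
    intro t h1 h2
    rcases h1.eq_or_lt with rfl | h1
    · exact hv
    rcases h2.eq_or_lt with rfl | h2
    · rw [hz]; exact h1
    · exact h1.trans_le (hleft t h2)
  have hzB : z ≤ B := hz ▸ (hAB z).2
  obtain ⟨y, hy, hyv⟩ : ∃ y ∈ Icc v (B + 1), F y ≤ v := by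
    by_contra! hc
    exact h.not_mapsTo hF hAB (by linarith) (Or.inl hAv) fun t ht =>
      ⟨hc t ht, by linarith [(hAB t).2]⟩
  have hzy : z ≤ y := by
    by_contra! hc
    linarith [habove y hy.1 hc.le]
  obtain ⟨y₀, hy₀, hy₀v, hlt⟩ := exists_first_eq (H := fun t => -F t) hF.neg (r := -v) hzy
    (by linarith) (by linarith)
  replace hy₀v : F y₀ = v := by linarith
  replace hlt : ∀ s, z ≤ s → s < y₀ → v < F s := fun s h1 h2 => by linarith [hlt s h1 h2]
  have hzy₀ : z < y₀ := lt_of_le_of_ne hy₀.1 fun h => by rw [← h, hz] at hy₀v; linarith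
  obtain ⟨w, hw, hmax⟩ := isCompact_Icc.exists_isMaxOn (nonempty_Icc.2 hvz.le) hF.continuousOn
  have hwM : ∀ t ∈ Icc v z, F t ≤ F w := fun t ht => hmax ht
  rcases le_or_gt y₀ (F w) with hyw | hyw
  · refine hno (leftTurn_of_jump hF hz (lt_of_le_of_ne hw.1 ?_) (lt_of_le_of_ne hw.2 ?_) hcon hzy₀
      hyw hy₀v.le)
    · rintro rfl; linarith
    · rintro rfl; linarith
  · obtain ⟨b, hb1, hb2⟩ := exists_between hyw
    have hzw := hwM z ⟨hvz.le, le_rfl⟩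
    rw [hz] at hzw
    refine h.not_mapsTo hF hAB (a := v) (b := b) (by linarith) (Or.inl hAv) fun t ht => ?_
    rcases le_or_gt t z with htz | htz
    · exact ⟨habove t ht.1 htz, (hwM t ⟨ht.1, htz⟩).trans_lt hb1⟩
    · exact ⟨hlt t htz.le (ht.2.trans_lt hb2), (hright t htz).trans_le ht.2⟩

/-- All points of [A, B] to the left of the least fixed point are sent beyond the greatest one; by
continuity at the least fixed point the two coincide. -/
theorem NoTrap.exists_swap {F : ℝ → ℝ} (hF : Continuous F) {A B : ℝ} (hAB : ∀ x, F x ∈ Icc A B)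
    (h : NoTrap F A B) (hno : ¬Turn F) {a : ℝ} (ha : a ∈ Icc A B) (haF : a < F a) :
    ∃ z, F z = z ∧ (∀ v, A ≤ v → v < z → z < F v) ∧ ∀ v, v ≤ B → z < v → F v < z := by
  have hmem : ∀ t, F t = t → t ∈ Icc A B := fun t ht => ht ▸ hAB t
  have hKc : IsCompact (Icc A B ∩ {t | F t = t}) :=
    isCompact_Icc.inter_right (isClosed_eq hF continuous_id)
  have hKne : (Icc A B ∩ {t | F t = t}).Nonempty := by
    obtain ⟨t, ht, ht0⟩ := intermediate_value_Icc' (ha.1.trans ha.2) (hF.sub continuous_id).continuousOn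
      (show (0 : ℝ) ∈ Icc _ _ from ⟨sub_nonpos.2 (hAB B).2, sub_nonneg.2 (hAB A).1⟩)
    exact ⟨t, ht, sub_eq_zero.1 ht0⟩
  obtain ⟨z₁, ⟨hz₁I, hz₁⟩, hz₁min⟩ := hKc.exists_isLeast hKne
  obtain ⟨z₂, ⟨hz₂I, hz₂⟩, hz₂max⟩ := hKc.exists_isGreatest hKne
  replace hz₁ : F z₁ = z₁ := hz₁
  replace hz₂ : F z₂ = z₂ := hz₂
  replace hz₁min : ∀ t, F t = t → z₁ ≤ t := fun t ht => hz₁min ⟨hmem t ht, ht⟩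
  replace hz₂max : ∀ t, F t = t → t ≤ z₂ := fun t ht => hz₂max ⟨hmem t ht, ht⟩
  have haz : a < z₁ := by
    rcases lt_trichotomy a z₁ with h1 | h1 | h1
    · exact h1
    · rw [h1, hz₁] at haF; exact absurd haF (lt_irrefl _)
    · exact absurd haF (not_lt.2 (h.ge_of_fixed_lt hF hAB hno hz₁ h1))
  have hright : ∀ t, z₂ < t → F t < t := fun t ht =>
    lt_of_le_of_ne (h.ge_of_fixed_lt hF hAB hno hz₂ ht) fun h => absurd ht (not_lt.2 (hz₂max t h))
  have hleft : ∀ t, t < z₁ → t < F t := fun t ht =>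
    lt_of_le_of_ne (h.le_of_lt_fixed hF hAB hno hz₁ ht) fun h =>
      absurd ht (not_lt.2 (hz₁min t h.symm))
  have h12 : z₁ ≤ z₂ := hz₁min z₂ hz₂
  have hswap : ∀ v, A ≤ v → v < z₁ → z₂ < F v := fun v hAv hv =>
    h.lt_of_fixed hF hAB (fun h => hno (Or.inl h)) hz₂ hright
      (fun t ht => h.le_of_lt_fixed hF hAB hno hz₂ ht) hAv (hv.trans_le h12) (hleft v hv)
  obtain rfl : z₁ = z₂ := by
    refine le_antisymm h12 ?_
    have hcl : z₁ ∈ closure (Ico a z₁) := by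
      rw [closure_Ico haz.ne]; exact ⟨haz.le, le_rfl⟩
    have := closure_minimal (t := {t | z₂ ≤ F t})
      (fun t ht => (hswap t (ha.1.trans ht.1) ht.2).le) (isClosed_le continuous_const hF) hcl
    exact this.trans_eq hz₁
  refine ⟨z₁, hz₁, hswap, fun v hv hzv => ?_⟩
  have := h.reflect.lt_of_fixed hF.reflect (reflect_mem hAB) (fun h => hno (Or.inr h))
    (z := -z₁) (v := -v) (by rw [reflect_apply, neg_neg, hz₁])
    (fun t ht => by rw [reflect_apply]; linarith [hleft (-t) (by linarith)])
    (fun t ht => by rw [reflect_apply]; linarith [hright (-t) (by linarith)])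
    (by linarith) (by linarith) (by rw [reflect_apply, neg_neg]; linarith [hright v hzv])
  rw [reflect_apply, neg_neg] at this
  linarith

/-- F² t < t would give a fold of F² on the left of z, which F sends across z: a turn. If F² x > x,
the interval from x to slightly beyond the maximum of F on [x, z] is trapped. -/
theorem NoTrap.sq_eq_of_swap_left {F : ℝ → ℝ} (hF : Continuous F) {A B : ℝ}
    (hAB : ∀ x, F x ∈ Icc A B) (h : NoTrap F A B) (hno : ¬LeftTurn F) {z : ℝ} (hz : F z = z)
    (hleft : ∀ v, v ≤ z → z ≤ F v) (hright : ∀ v, z ≤ v → F v ≤ z) {x : ℝ} (hAx : A ≤ x)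
    (hxz : x < z) : F (F x) = x := by
  have hzB : z ≤ B := hz ▸ (hAB z).2
  have hge : ∀ t, t < z → t ≤ F (F t) := by
    intro t ht
    by_contra! hcon
    obtain ⟨y, e, p, hye, hep, hpz, hy, hp, he⟩ := exists_turn_of_lt (G := fun t => F (F t))
      (hF.comp hF) (fun x => (hAB _).1) (show F (F z) = z by rw [hz, hz]) ht hcon
      fun a b hab hbz => h.not_mapsTo_sq hF hAB hab hbz hzB fun t ht =>
        hleft t (ht.2.trans hbz.le)
    exact hno ⟨y, e, p, z, hye, hep, hpz, hleft y (by linarith), hleft e (by linarith),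
      hleft p hpz, hy.ge, hp.ge, he⟩
  by_contra hne
  have hx : x < F (F x) := lt_of_le_of_ne (hge x hxz) (Ne.symm hne)
  have habove : ∀ t ∈ Icc x z, x < F (F t) := by
    intro t ht
    rcases ht.1.eq_or_lt with rfl | h1
    · exact hx
    rcases ht.2.eq_or_lt with rfl | h2
    · rw [hz, hz]; exact h1
    · exact h1.trans_le (hge t h2)
  obtain ⟨w, hw, hmax⟩ := isCompact_Icc.exists_isMaxOn (nonempty_Icc.2 hxz.le) hF.continuousOn
  have hwM : ∀ t ∈ Icc x z, F t ≤ F w := fun t ht => hmax ht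
  have hzw : z ≤ F w := hleft w hw.2
  -- The right end must exceed the maximum F w strictly; continuity at F w keeps F above x on the
  -- added piece.
  obtain ⟨δ, hδ, hb⟩ := Metric.eventually_nhds_iff.1
    (hF.continuousAt.eventually (lt_mem_nhds (habove w hw)))
  refine h.not_mapsTo hF hAB (a := x) (b := F w + δ / 2) (by linarith) (Or.inl hAx) fun t ht => ?_
  rcases le_or_gt t z with htz | htz
  · exact ⟨hxz.trans_le (hleft t htz), by linarith [hwM t ⟨ht.1, htz⟩]⟩
  refine ⟨?_, by linarith [hright t htz.le]⟩
  rcases le_or_gt t (F w) with htw | htw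
  · obtain ⟨s, hs, rfl⟩ := intermediate_value_Icc' hw.2 hF.continuousOn
      (show t ∈ Icc (F z) (F w) from ⟨by rw [hz]; exact htz.le, htw⟩)
    exact habove s ⟨hw.1.trans hs.1, hs.2⟩
  · refine hb ?_
    rw [Real.dist_eq, abs_lt]; constructor <;> linarith [ht.2]

theorem NoTrap.sq_eq {F : ℝ → ℝ} (hF : Continuous F) {A B : ℝ} (hAB : ∀ x, F x ∈ Icc A B)
    (hFA : ∀ t ≤ A, F t = F A) (hFB : ∀ t, B ≤ t → F t = F B) (h : NoTrap F A B) (hno : ¬Turn F)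
    {a : ℝ} (ha : a ∈ Icc A B) : F (F a) = a := by
  by_contra hne
  have hsw : ∃ z, F z = z ∧ (∀ v, A ≤ v → v < z → z < F v) ∧ ∀ v, v ≤ B → z < v → F v < z := by
    rcases lt_trichotomy a (F a) with h1 | h1 | h1
    · exact h.exists_swap hF hAB hno ha h1
    · exact absurd (by rw [← h1, ← h1]) hne
    · obtain ⟨z, hz, h2, h3⟩ := h.reflect.exists_swap hF.reflect (reflect_mem hAB)
        (fun h => hno (turn_reflect.1 h)) (a := -a) ⟨neg_le_neg ha.2, neg_le_neg ha.1⟩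
        (by rw [reflect_apply, neg_neg]; linarith)
      rw [reflect_apply] at hz
      refine ⟨-z, by linarith, fun v h4 h5 => ?_, fun v h4 h5 => ?_⟩
      · have := h3 (-v) (by linarith) (by linarith)
        rw [reflect_apply, neg_neg] at this
        linarith
      · have := h2 (-v) (by linarith) (by linarith)
        rw [reflect_apply, neg_neg] at this
        linarith
  obtain ⟨z, hz, hl, hr⟩ := hsw
  have hzI : z ∈ Icc A B := hz ▸ hAB z
  have hl' : ∀ v, v ≤ z → z ≤ F v := by
    have : ∀ v, A ≤ v → v ≤ z → z ≤ F v := by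
      intro v h1 h2
      rcases h2.eq_or_lt with rfl | h2
      · exact hz.ge
      · exact (hl v h1 h2).le
    intro v hv
    rcases le_total A v with h1 | h1
    · exact this v h1 hv
    · rw [hFA v h1]; exact this A le_rfl hzI.1
  have hr' : ∀ v, z ≤ v → F v ≤ z := by
    have : ∀ v, v ≤ B → z ≤ v → F v ≤ z := by
      intro v h1 h2
      rcases h2.eq_or_lt with rfl | h2
      · exact hz.le
      · exact (hr v h1 h2).le
    intro v hv
    rcases le_total v B with h1 | h1
    · exact this v h1 hv
    · rw [hFB v h1]; exact this B le_rfl hzI.2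
  rcases lt_trichotomy a z with h1 | h1 | h1
  · exact hne (h.sq_eq_of_swap_left hF hAB (fun h => hno (Or.inl h)) hz hl' hr' ha.1 h1)
  · exact hne (by rw [h1, hz, hz])
  · have := h.reflect.sq_eq_of_swap_left hF.reflect (reflect_mem hAB) (fun h => hno (Or.inr h))
      (z := -z) (x := -a) (by rw [reflect_apply, neg_neg, hz])
      (fun v hv => by rw [reflect_apply]; linarith [hr' (-v) (by linarith)])
      (fun v hv => by rw [reflect_apply]; linarith [hl' (-v) (by linarith)])
      (by linarith [ha.2]) (by linarith)
    simp only [reflect_apply, neg_neg, neg_inj] at this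
    exact hne this

/-! ### Self-maps of a compact interval as self-maps of the line -/

section Line

variable {α β : ℝ} (hαβ : α ≤ β) {f : Icc α β → Icc α β}

/-- The extension of a self-map of `[α, β]` to the line that is constant on either side. -/
noncomputable def lineExtension (f : Icc α β → Icc α β) : ℝ → ℝ := fun x => f (projIcc α β hαβ x)

theorem lineExtension_mem (x : ℝ) : lineExtension hαβ f x ∈ Icc α β := (f _).2

theorem continuous_lineExtension (hf : Continuous f) : Continuous (lineExtension hαβ f) :=
  continuous_subtype_val.comp (hf.comp continuous_projIcc)

theorem lineExtension_coe (x : Icc α β) : lineExtension hαβ f x = f x := by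
  rw [lineExtension, projIcc_val]

theorem lineExtension_iterate (n : ℕ) (x : Icc α β) :
    (lineExtension hαβ f)^[n] x = f^[n] x := by
  induction n with
  | zero => rfl
  | succ n ih => rw [Function.iterate_succ_apply', Function.iterate_succ_apply', ih,
      lineExtension_coe]

theorem minimalPeriod_lineExtension (x : Icc α β) :
    Function.minimalPeriod (lineExtension hαβ f) x = Function.minimalPeriod f x := by
  rw [Function.minimalPeriod_eq_minimalPeriod_iff]
  intro n
  rw [Function.IsPeriodicPt, Function.IsPeriodicPt, Function.IsFixedPt, Function.IsFixedPt,
    lineExtension_iterate, Subtype.coe_inj]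

/-- The ends a and b are bounded by values of F², so they lie in [α, β]; the two legs, meeting only
in e, are the intervals required for turbulence. -/
theorem HasTurn.isTurbulentOn (hf : Continuous f) {a e b : ℝ}
    (h : HasTurn (fun x => lineExtension hαβ f (lineExtension hαβ f x)) a e b) :
    ∃ (ha : a ∈ Icc α β) (hb : b ∈ Icc α β), IsTurbulentOn f^[2] (Icc ⟨a, ha⟩ ⟨b, hb⟩) := by
  have hF := continuous_lineExtension hαβ hf
  set F := lineExtension hαβ f with hFdef
  have hmem : ∀ x, F (F x) ∈ Icc α β := fun x => lineExtension_mem hαβ _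
  obtain ⟨hae, heb, hturn⟩ := h
  simp only at hturn
  have hcov : Icc a b ⊆ (fun x => F (F x)) '' Icc a e ∧ Icc a b ⊆ (fun x => F (F x)) '' Icc e b := by
    rcases hturn with ⟨h1, h2, h3⟩ | ⟨h1, h2, h3⟩
    · exact ⟨(Icc_subset_Icc h3 h1).trans (intermediate_value_Icc' hae.le (hF.comp hF).continuousOn),
        (Icc_subset_Icc h3 h2).trans (intermediate_value_Icc heb.le (hF.comp hF).continuousOn)⟩
    · exact ⟨(Icc_subset_Icc h1 h3).trans (intermediate_value_Icc hae.le (hF.comp hF).continuousOn),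
        (Icc_subset_Icc h2 h3).trans (intermediate_value_Icc' heb.le (hF.comp hF).continuousOn)⟩
  have hαa : α ≤ a := by
    rcases hturn with ⟨h1, h2, h3⟩ | ⟨h1, h2, h3⟩
    · exact (hmem e).1.trans h3
    · exact (hmem a).1.trans h1
  have hbβ : b ≤ β := by
    rcases hturn with ⟨h1, h2, h3⟩ | ⟨h1, h2, h3⟩
    · exact h1.trans (hmem a).2
    · exact h3.trans (hmem e).2
  have hab := hae.trans heb
  refine ⟨⟨hαa, hab.le.trans hbβ⟩, ⟨hαa.trans hab.le, hbβ⟩, ?_⟩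
  obtain ⟨a, rfl⟩ : ∃ a' : Icc α β, (a' : ℝ) = a := ⟨⟨a, hαa, hab.le.trans hbβ⟩, rfl⟩
  obtain ⟨b, rfl⟩ : ∃ b' : Icc α β, (b' : ℝ) = b := ⟨⟨b, hαa.trans hab.le, hbβ⟩, rfl⟩
  obtain ⟨e, rfl⟩ : ∃ e' : Icc α β, (e' : ℝ) = e :=
    ⟨⟨e, hαa.trans hae.le, heb.le.trans hbβ⟩, rfl⟩
  have himg : ∀ u v : Icc α β, Icc (a : ℝ) b ⊆ (fun x => F (F x)) '' Icc (u : ℝ) v →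
      Icc a b ⊆ f^[2] '' Icc u v := by
    intro u v huv t ht
    obtain ⟨s, hs, hst⟩ := huv (show (t : ℝ) ∈ Icc (a : ℝ) b from ht)
    lift s to Icc α β using ⟨u.2.1.trans hs.1, hs.2.trans v.2.2⟩
    refine ⟨s, hs, Subtype.ext ?_⟩
    rw [← lineExtension_iterate hαβ]
    exact hst
  refine ⟨a, e, e, b, hae, heb, Icc_subset_Icc le_rfl heb.le, Icc_subset_Icc hae.le le_rfl, ?_, ?_⟩
  · rintro x hx y hy
    exact (le_antisymm hx.1.2 hx.2.1).trans (le_antisymm hy.1.2 hy.2.1).symm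
  · refine Subset.trans (union_subset (Icc_subset_Icc le_rfl heb.le) (Icc_subset_Icc hae.le le_rfl))
      (subset_inter (himg a e hcov.1) (himg e b hcov.2))

theorem Turn.hasAllEvenPeriods_and_isDoublyTurbulent (hf : Continuous f)
    (h : Turn (lineExtension hαβ f)) : HasAllEvenPeriods f ∧ IsDoublyTurbulent f^[2] := by
  have hF := continuous_lineExtension hαβ hf
  constructor
  · intro m hm
    obtain ⟨x, hx⟩ := h.exists_minimalPeriod hF m hm
    have hmem : x ∈ Icc α β := by
      have hper := Function.isPeriodicPt_minimalPeriod (lineExtension hαβ f) x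
      rw [hx, Function.IsPeriodicPt, Function.IsFixedPt,
        show 2 * m = (2 * m - 1) + 1 by omega, Function.iterate_succ_apply'] at hper
      exact hper ▸ lineExtension_mem hαβ _
    lift x to Icc α β using hmem
    exact ⟨x, by rw [← minimalPeriod_lineExtension hαβ, hx]⟩
  · obtain ⟨a, e, b, a', e', b', hle, h1, h2⟩ := h.exists_two_turns hF
    obtain ⟨ha, hb, ht⟩ := h1.isTurbulentOn hαβ hf
    obtain ⟨ha', hb', ht'⟩ := h2.isTurbulentOn hαβ hf
    refine ⟨⟨a, ha⟩, ⟨b, hb⟩, ⟨a', ha'⟩, ⟨b', hb'⟩, h1.1.trans h1.2.1, h2.1.trans h2.2.1, ?_, ht, ht'⟩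
    intro x hx y hy
    have key : ∀ t : Icc α β, t ∈ Icc (⟨a, ha⟩ : Icc α β) ⟨b, hb⟩ ∩ Icc ⟨a', ha'⟩ ⟨b', hb'⟩ →
        (t : ℝ) = b := fun t ht => le_antisymm ht.1.2 (hle.trans ht.2.1)
    exact Subtype.ext ((key x hx).trans (key y hy).symm)

/-! ### The conditions of the theorem force a turn -/

theorem isBoundedUnder_le_dist (u v : ℕ → Icc α β) :
    IsBoundedUnder (· ≤ ·) atTop fun n => dist (u n) (v n) :=
  isBoundedUnder_of ⟨β - α, fun n => Real.dist_le_of_mem_Icc (u n).2 (v n).2⟩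

theorem frequently_dist_lt {u v : ℕ → Icc α β}
    (h : liminf (fun n => dist (u n) (v n)) atTop = 0) {ε : ℝ} (hε : 0 < ε) :
    ∃ᶠ n in atTop, dist (u n) (v n) < ε :=
  frequently_lt_of_liminf_lt (isBoundedUnder_le_dist u v).isCoboundedUnder_ge (h ▸ hε)

theorem turn_of_dense_proximalPairs (hf : Continuous f)
    (hx : ∃ x : Icc α β, ¬IsAsymptPeriodicOneOrTwo f x) (hd : Dense (proximalPairs f)) :
    Turn (lineExtension hαβ f) := by
  by_contra hno
  obtain ⟨c, hc⟩ := hx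
  obtain ⟨u₁, u₂, w₁, w₂, hu, hw, hu₁, hu₂, hw₁, hw₂, hdist⟩ :=
    exists_distal_intervals (continuous_lineExtension hαβ hf) (lineExtension_mem hαβ) hno c.2 (by
      rintro ⟨y, hy, hyy, hlim⟩
      lift y to Icc α β using hy
      refine hc ⟨y, Subtype.ext ?_, ?_⟩
      · rwa [lineExtension_coe, lineExtension_coe] at hyy
      · simp only [lineExtension_iterate] at hlim
        exact hlim)
  have hopen : ∀ a b : ℝ, IsOpen {t : Icc α β | (t : ℝ) ∈ Ioo a b} := fun a b =>
    isOpen_Ioo.preimage continuous_subtype_val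
  have hne : ∀ a b : ℝ, a < b → a ∈ Icc α β → b ∈ Icc α β →
      {t : Icc α β | (t : ℝ) ∈ Ioo a b}.Nonempty := fun a b hab ha hb => by
    obtain ⟨t, ht⟩ := exists_between hab
    exact ⟨⟨t, ha.1.trans ht.1.le, ht.2.le.trans hb.2⟩, ht⟩
  obtain ⟨⟨u, w⟩, ⟨hu', hw'⟩, hprox⟩ := hd.inter_open_nonempty _
    ((hopen u₁ u₂).prod (hopen w₁ w₂)) ((hne _ _ hu hu₁ hu₂).prod (hne _ _ hw hw₁ hw₂))
  obtain ⟨δ, hδ, hle⟩ := hdist u hu' w hw'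
  simp only [lineExtension_iterate] at hle
  have h0 : liminf (fun n : ℕ => dist (f^[n] u) (f^[n] w)) atTop = 0 := hprox
  have h1 : δ ≤ liminf (fun n : ℕ => dist (f^[n] u) (f^[n] w)) atTop := by
    exact le_liminf_of_le (isBoundedUnder_le_dist _ _).isCoboundedUnder_ge
      (Eventually.of_forall fun n => hle n)
  linarith

/-- Two orbits asymptotic to the same orbit of period at most 2 in the same phase have distance
tending to 0; otherwise their distance is eventually bounded below. Neither is possible for a
Li–Yorke pair. -/
theorem exists_not_isAsymptPeriodicOneOrTwo {x y : Icc α β} (h : (x, y) ∈ liYorkePairs f) :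
    ∃ x, ¬IsAsymptPeriodicOneOrTwo f x := by
  by_contra! hcon
  obtain ⟨p, hp, hxp⟩ := hcon x
  obtain ⟨q, hq, hyq⟩ := hcon y
  have hsup : 0 < limsup (fun n : ℕ => dist (f^[n] x) (f^[n] y)) atTop := h.1
  have hinf : liminf (fun n : ℕ => dist (f^[n] x) (f^[n] y)) atTop = 0 := h.2
  by_cases hpq : p = q
  · subst hpq
    have hlim : Tendsto (fun n : ℕ => dist (f^[n] x) (f^[n] y)) atTop (𝓝 0) := by
      refine squeeze_zero (fun _ => dist_nonneg) (fun n => dist_triangle_right _ _ (f^[n] p)) ?_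
      simpa using hxp.add hyq
    rw [hlim.limsup_eq] at hsup
    exact lt_irrefl _ hsup
  · have hfpq : f p ≠ f q := fun he => hpq (by rw [← hp, he, hq])
    obtain ⟨δ, hδ, h1, h2⟩ : ∃ δ > 0, δ ≤ dist p q ∧ δ ≤ dist (f p) (f q) :=
      ⟨_, lt_min (dist_pos.2 hpq) (dist_pos.2 hfpq), min_le_left _ _, min_le_right _ _⟩
    have hδn : ∀ n, δ ≤ dist (f^[n] p) (f^[n] q) := by
      intro n
      have hfix : ∀ t, f (f t) = t → ∀ k, f^[2 * k] t = t := fun t ht k => by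
        rw [Function.iterate_mul]
        exact Function.iterate_fixed (f := f^[2]) ht k
      rcases Nat.even_or_odd' n with ⟨k, rfl | rfl⟩
      · rwa [hfix p hp, hfix q hq]
      · rwa [Function.iterate_succ_apply', Function.iterate_succ_apply', hfix p hp, hfix q hq]
    have hev : ∀ᶠ n in atTop, dist (f^[n] x) (f^[n] p) + dist (f^[n] y) (f^[n] q) < δ / 2 := by
      have := hxp.add hyq
      rw [add_zero] at this
      exact this.eventually (gt_mem_nhds (half_pos hδ))
    obtain ⟨n, hn1, hn2⟩ := ((frequently_dist_lt hinf (half_pos hδ)).and_eventually hev).exists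
    have := dist_triangle4 (f^[n] p) (f^[n] x) (f^[n] y) (f^[n] q)
    rw [dist_comm (f^[n] p) (f^[n] x)] at this
    linarith [hδn n]

/-- An ε-chain starting at a chain recurrent point of C never leaves C, and its last step puts that
point within ε of the image of C. -/
theorem noTrap_of_dense_isChainRecurrentPt
    (hd : Dense {x : Icc α β | IsChainRecurrentPt f x}) : NoTrap (lineExtension hαβ f) α β := by
  intro C ε hε hC u v hu hv huv huC
  obtain ⟨m, hm⟩ := exists_between huv
  obtain ⟨x, hx, hxr⟩ := hd.inter_open_nonempty {t : Icc α β | (t : ℝ) ∈ Ioo u v}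
    (isOpen_Ioo.preimage continuous_subtype_val)
    ⟨⟨m, hu.trans hm.1.le, hm.2.le.trans hv⟩, hm⟩
  obtain ⟨n, c, hn, hc0, hcn, hc⟩ := hxr ε hε
  have hstep : ∀ i < n, |lineExtension hαβ f (c i) - c (i + 1)| < ε := fun i hi => by
    rw [lineExtension_coe]; exact hc i hi
  have hmem : ∀ i, i < n → (c i : ℝ) ∈ C := by
    intro i
    induction i with
    | zero => intro _; rw [hc0]; exact huC hx
    | succ i ih => exact fun hi => hC _ (ih (by omega)) _ (hstep i (by omega))
  refine ⟨x, hx, c (n - 1), hmem _ (by omega), ?_⟩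
  have := hstep (n - 1) (by omega)
  rwa [Nat.sub_add_cancel hn, hcn] at this

theorem turn_of_dense_isChainRecurrentPt (hf : Continuous f)
    (hd : Dense {x : Icc α β | IsChainRecurrentPt f x}) (ha : ∃ a : Icc α β, f^[2] a ≠ a) :
    Turn (lineExtension hαβ f) := by
  by_contra hno
  obtain ⟨a, ha⟩ := ha
  refine ha (Subtype.ext ?_)
  rw [← lineExtension_iterate hαβ]
  refine (noTrap_of_dense_isChainRecurrentPt hαβ hd).sq_eq (continuous_lineExtension hαβ hf)
    (lineExtension_mem hαβ) (fun t ht => ?_) (fun t ht => ?_) hno a.2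
  · rw [lineExtension, lineExtension, projIcc_of_le_left hαβ ht, projIcc_left]
  · rw [lineExtension, lineExtension, projIcc_of_right_le hαβ ht, projIcc_right]

theorem turn_of_odd_return (hf : Continuous f) {c : Icc α β} {n : ℕ} (hn : Odd n)
    (h : (f^[n] c ≤ c ∧ c < f c) ∨ (f c < c ∧ c ≤ f^[n] c)) : Turn (lineExtension hαβ f) := by
  have hF := continuous_lineExtension hαβ hf
  rcases h with ⟨h1, h2⟩ | ⟨h1, h2⟩
  · refine turn_of_odd_return_le hF (fun x => (lineExtension_mem hαβ x).2) (c := c) hn ?_ ?_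
    · rwa [lineExtension_iterate, Subtype.coe_le_coe]
    · rwa [lineExtension_coe, Subtype.coe_lt_coe]
  · refine turn_of_odd_return_ge hF (fun x => (lineExtension_mem hαβ x).1) (c := c) hn ?_ ?_
    · rwa [lineExtension_iterate, Subtype.coe_le_coe]
    · rwa [lineExtension_coe, Subtype.coe_lt_coe]

theorem mapClusterPt_lineExtension {b z : Icc α β} (h : z ∈ omegaLimitSet f b) :
    MapClusterPt (z : ℝ) atTop fun n => (lineExtension hαβ f)^[n] (b : ℝ) := by
  rw [omegaLimitSet, mem_omegaLimit_singleton_iff_mapClusterPt] at h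
  simp only [lineExtension_iterate]
  exact h.continuousAt_comp continuous_subtype_val.continuousAt

theorem turn_of_dist_iterate (hf : Continuous f) {c : Icc α β}
    (hsup : 0 < limsup (fun n : ℕ => dist (f^[n] c) (f^[n + 1] c)) atTop)
    (hinf : liminf (fun n : ℕ => dist (f^[n] c) (f^[n + 1] c)) atTop = 0) :
    Turn (lineExtension hαβ f) := by
  by_contra hno
  obtain ⟨p, -, hlim⟩ := exists_tendsto_of_frequently_dist_lt (continuous_lineExtension hαβ hf)
    (lineExtension_mem hαβ) hno (c := c) fun ε hε => by
      simp only [lineExtension_iterate]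
      exact frequently_dist_lt hinf hε
  have h1 := (hlim.sub ((tendsto_add_atTop_iff_nat 1).2 hlim)).abs
  simp only [lineExtension_iterate, sub_self, abs_zero] at h1
  have h2 : limsup (fun n : ℕ => dist (f^[n] c) (f^[n + 1] c)) atTop = 0 := h1.limsup_eq
  exact hsup.ne' h2

end Line

/-- The interval is `I = [α, β]`, a subspace of the real line, so that `dist x y = |x - y|`. -/
theorem corollary2 (α β : ℝ) (hαβ : α ≤ β) (f : Icc α β → Icc α β) (hf : Continuous f) :
    -- (1)
    ((∃ (c : Icc α β) (n : ℕ), Odd n ∧ 1 < n ∧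
        ((f^[n] c ≤ c ∧ c < f c) ∨ (f c < c ∧ c ≤ f^[n] c))) →
      HasAllEvenPeriods f ∧ IsDoublyTurbulent f^[2]) ∧
    -- (1), the particular case
    ((∃ c : Icc α β, Odd (Function.minimalPeriod f c) ∧ 1 < Function.minimalPeriod f c) →
      HasAllEvenPeriods f ∧ IsDoublyTurbulent f^[2]) ∧
    -- (2)
    (Dense {x : Icc α β | IsChainRecurrentPt f x} ∧ (∃ a : Icc α β, f^[2] a ≠ a) →
      HasAllEvenPeriods f ∧ IsDoublyTurbulent f^[2]) ∧
    -- (3)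
    ((∃ b z y : Icc α β, f z = z ∧ y ≠ z ∧ z ∈ omegaLimitSet f b ∧ y ∈ omegaLimitSet f b) →
      HasAllEvenPeriods f ∧ IsDoublyTurbulent f^[2]) ∧
    -- (4)
    ((∃ x : Icc α β, ¬ IsAsymptPeriodicOneOrTwo f x) ∧ Dense (proximalPairs f) →
      HasAllEvenPeriods f ∧ IsDoublyTurbulent f^[2]) ∧
    -- (4), the particular case
    (IsDenselyChaotic f → HasAllEvenPeriods f ∧ IsDoublyTurbulent f^[2]) ∧
    -- (5)
    ((∃ c : Icc α β,
        0 < limsup (fun n : ℕ => dist (f^[n] c) (f^[n + 1] c)) atTop ∧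
        liminf (fun n : ℕ => dist (f^[n] c) (f^[n + 1] c)) atTop = 0) →
      HasAllEvenPeriods f ∧ IsDoublyTurbulent f^[2]) := by
  have key := fun h => Turn.hasAllEvenPeriods_and_isDoublyTurbulent hαβ hf h
  have case4 : (∃ x : Icc α β, ¬IsAsymptPeriodicOneOrTwo f x) ∧ Dense (proximalPairs f) →
      HasAllEvenPeriods f ∧ IsDoublyTurbulent f^[2] := fun ⟨hx, hd⟩ =>
    key (turn_of_dense_proximalPairs hαβ hf hx hd)
  refine ⟨?_, ?_, ?_, ?_, case4, ?_, ?_⟩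
  · rintro ⟨c, n, hn, -, h⟩
    exact key (turn_of_odd_return hαβ hf hn h)
  · rintro ⟨c, hodd, hlt⟩
    have hper : f^[Function.minimalPeriod f c] c = c := Function.isPeriodicPt_minimalPeriod f c
    have hne : f c ≠ c := fun h => by
      rw [Function.minimalPeriod_eq_one_iff_isFixedPt.2 h] at hlt
      exact lt_irrefl _ hlt
    refine key (turn_of_odd_return hαβ hf (c := c) hodd ?_)
    rcases lt_or_gt_of_ne hne with h | h
    · exact Or.inr ⟨h, hper.ge⟩
    · exact Or.inl ⟨hper.le, h⟩
  · rintro ⟨hd, ha⟩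
    exact key (turn_of_dense_isChainRecurrentPt hαβ hf hd ha)
  · rintro ⟨b, z, y, hz, hyz, hbz, hby⟩
    exact key (turn_of_mapClusterPt (continuous_lineExtension hαβ hf) (lineExtension_mem hαβ)
      (by rw [lineExtension_coe, hz]) (fun h => hyz (Subtype.ext h))
      (mapClusterPt_lineExtension hαβ hbz) (mapClusterPt_lineExtension hαβ hby))
  · intro hd
    have : Nonempty (Icc α β × Icc α β) := ⟨(⟨α, le_rfl, hαβ⟩, ⟨α, le_rfl, hαβ⟩)⟩
    obtain ⟨⟨x, y⟩, hxy⟩ := hd.nonempty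
    exact case4 ⟨exists_not_isAsymptPeriodicOneOrTwo hxy, hd.mono fun w hw => hw.2⟩
  · rintro ⟨c, hsup, hinf⟩
    exact key (turn_of_dist_iterate hαβ hf hsup hinf)
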